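/- Let $\mathcal G=(X,E)$ be a finite graph with non-negative symmetric conductances $C_{x,y}=C_{y,x}$ (zero unless $\{x,y\}\in E$; no self-loops) and a non-negative killing measure $\kappa$ on $X$, such that the energy $\mathcal E(f,f)=\frac12\sum_{x,y}C_{x,y}(f(x)-f(y))^2+\sum_x\kappa_xf(x)^2$ is positive definite. Put $\lambda_x=\sum_yC_{x,y}+\kappa_x$ and $P_{x,y}=C_{x,y}/\lambda_x$, the transition matrix of the associated Markov chain. A based loop is a cyclic sequence of $p\ge1$ successive positions in $X$ with a starting point, together with a holding time at each of them; a loop is a class of based loops under shift of the base point. The loop measure $\mu$ gives to a discrete loop with at least two points the product of the transition probabilities of its edges divided by its multiplicity, its holding times being independent exponential variables of mean $1$; on one-point loops at $x$ it is the measure with holding-time density $e^{-t}/t$, $t>0$, for each $x \in X$. Equivalently, $\mu$ is the image of the measure on based loops in which a discrete based loop with $p\ge2$ points has mass $\frac1p\prod P$. For $\alpha>0$ let $\mathcal L_\alpha$ be a Poisson point process of loops of intensity $\alpha\mu$, let $N^{(\alpha)}_{x,y}$ be the total number of jumps from $x$ to $y$ ($x\neq y$) made by the loops of $\mathcal L_\alpha$,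 with $N^{(\alpha)}_{x,x}=0$, and let $N=N^{(1)}$. A network is a matrix $k=(k_{x,y})_{x,y\in X}$ of non-negative integers that vanishes on the diagonal and on the entries $(x,y)$ with $\{x,y\}\notin E$; it is Eulerian if $\sum_yk_{x,y}=\sum_yk_{y,x}$ for every $x$, and then $k_x$ denotes this common value, and $|k|=\sum_xk_x$. For a square matrix $A$ let $\mathrm{Per}_\alpha(A)=\sum_\sigma\alpha^{m(\sigma)}\prod_iA_{i,\sigma(i)}$, where $m(\sigma)$ is the number of cycles of the permutation $\sigma$ (fixed points included). Then for every Eulerian network $k$: i) For every $\alpha>0$, $$\mathbb P(N^{(\alpha)}=k)=\frac{C}{\prod_xk_x!}\,\det(I-P)^{\alpha}\prod_{x,y}P_{x,y}^{k_{x,y}},$$ where $C$ is the coefficient of $\prod_{x,y}P_{x,y}^{k_{x,y}}$ in $\mathrm{Per}_\alpha(P(k_x,\,x\in X))$, the entries of $P$ being regarded as independent indeterminates, and $P(k_x,\,x\in X)$ is the $|k|\times|k|$ matrix obtained from $P$ by repeating, for each $x$, the column and the row of index $x$ $k_x$ times. ii) For $\alpha=1$, $$\mathbb P(N=k)=\det(I-P)\,\frac{\prod_xk_x!}{\prod_{x,y}k_{x,y}!}\,\prod_{x,y}P_{x,y}^{k_{x,y}}.$$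 -/

import Mathlib

open MeasureTheory ProbabilityTheory

noncomputable section

/-! ## Finite graphs with conductances and killing -/

/-- A graph on `X` with non negative symmetric conductances carried by its edges and a non
negative killing measure on its vertices. -/
structure ConductanceGraph (X : Type*) where
  graph : SimpleGraph X
  cond : X → X → ℝ
  kill : X → ℝ
  cond_nonneg : ∀ x y, 0 ≤ cond x y
  cond_symm : ∀ x y, cond x y = cond y x
  cond_eq_zero : ∀ x y, ¬ graph.Adj x y → cond x y = 0
  kill_nonneg : ∀ x, 0 ≤ kill x

namespace ConductanceGraph

variable {X : Type*} [Fintype X] (G : ConductanceGraph X)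

/-- The energy (Dirichlet form) `ℰ(f, f)`. -/
def energy (f : X → ℝ) : ℝ :=
  (1 / 2) * (∑ x, ∑ y, G.cond x y * (f x - f y) ^ 2) + ∑ x, G.kill x * f x ^ 2

/-- Transience: the energy is positive definite. -/
def IsTransient : Prop := ∀ f : X → ℝ, f ≠ 0 → 0 < G.energy f

/-- The duality measure `λ`. -/
def dualityMeasure (x : X) : ℝ := (∑ y, G.cond x y) + G.kill x

/-- The transition matrix `P` of the discrete time chain: from `x` the chain jumps to `y` with
probability `C x y / λ x` (and to the cemetery with probability `κ x / λ x`). -/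
def transition : Matrix X X ℝ := Matrix.of fun x y => G.cond x y / G.dualityMeasure x

end ConductanceGraph

/-! ## Loops -/

/-- A based loop: `n + 1` successive positions, each with its holding time; the last position is
followed by the first one. -/
abbrev BasedLoop (X : Type*) := Σ n : ℕ, (Fin (n + 1) → X × ℝ)

/-- Shifting the base point of a based loop (the addition in `Fin (n + 1)` is cyclic). -/
def BasedLoop.shift {X : Type*} (l : BasedLoop X) (s : Fin (l.1 + 1)) : BasedLoop X :=
  ⟨l.1, fun i => l.2 (i + s)⟩

/-- Two based loops are equivalent if one is a shift of the other. -/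
def shiftSetoid (X : Type*) : Setoid (BasedLoop X) where
  r l l' := ∃ s, l' = l.shift s
  iseqv :=
    { refl := by
        rintro ⟨n, w⟩
        exact ⟨(0 : Fin (n + 1)), by simp [BasedLoop.shift]⟩
      symm := by
        rintro ⟨n, w⟩ _ ⟨s, rfl⟩
        change Fin (n + 1) at s
        refine ⟨(-s : Fin (n + 1)), ?_⟩
        have h : ∀ i : Fin (n + 1), i + -s + s = i := fun i => neg_add_cancel_right i s
        exact Sigma.ext rfl (heq_of_eq (funext fun i => congrArg w (h i).symm))
      trans := by
        rintro ⟨n, w⟩ _ _ ⟨s, rfl⟩ ⟨t, rfl⟩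
        change Fin (n + 1) at s t
        refine ⟨(t + s : Fin (n + 1)), ?_⟩
        have h : ∀ i : Fin (n + 1), i + t + s = i + (t + s) := fun i => add_assoc i t s
        exact Sigma.ext rfl (heq_of_eq (funext fun i => congrArg w (h i))) }

/-- Loops: based loops up to shift, with the quotient `σ`-algebra. -/
abbrev Loop (X : Type*) := Quotient (shiftSetoid X)

/-- The number of jumps from `x` to `y` made by a based loop. A jump changes the position, so
that there is none from a point to itself; in particular one point loops make no jump. -/
def BasedLoop.jumps {X : Type*} [DecidableEq X] (x y : X) (l : BasedLoop X) : ℕ :=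
  (Finset.univ.filter fun i : Fin (l.1 + 1) =>
    x ≠ y ∧ (l.2 i).1 = x ∧ (l.2 (i + 1)).1 = y).card

/-- The number of jumps from `x` to `y` made by a loop. -/
def Loop.jumps {X : Type*} [DecidableEq X] (x y : X) (l : Loop X) : ℕ :=
  Quotient.lift (BasedLoop.jumps x y) (by
    rintro ⟨n, w⟩ _ ⟨s, rfl⟩
    change Fin (n + 1) at s
    symm
    refine Finset.card_equiv (Equiv.addRight (s : Fin (n + 1))) fun i => ?_
    change Fin (n + 1) at i
    have h : (x ≠ y ∧ (w (i + s)).1 = x ∧ (w (i + 1 + s)).1 = y) ↔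
        (x ≠ y ∧ (w (i + s)).1 = x ∧ (w (i + s + 1)).1 = y) := by
      rw [add_right_comm i 1 s]
    exact ⟨fun hi => Finset.mem_filter.2 ⟨Finset.mem_univ _, h.1 (Finset.mem_filter.1 hi).2⟩,
      fun hi => Finset.mem_filter.2 ⟨Finset.mem_univ _, h.2 (Finset.mem_filter.1 hi).2⟩⟩) l

namespace ConductanceGraph

variable {X : Type*} [Fintype X] [MeasurableSpace X] (G : ConductanceGraph X)

/-- The measure on based loops. A discrete based loop with `p = n + 2 ≥ 2` points has mass `1 / p`
times the product of its transition probabilities, and its holding times are independent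
exponential variables of mean `1`. For the one point loops the holding time has density
`exp (-t) / t` on `(0, ∞)`. -/
def basedLoopMeasure : Measure (BasedLoop X) :=
  (∑ x : X, Measure.map (fun t : ℝ => (⟨0, fun _ => (x, t)⟩ : BasedLoop X))
    ((volume.restrict (Set.Ioi (0 : ℝ))).withDensity
      fun t => ENNReal.ofReal (Real.exp (-t) / t)))
  + Measure.sum fun n : ℕ => ∑ x : Fin (n + 2) → X,
      ENNReal.ofReal ((∏ i, G.transition (x i) (x (i + 1))) / ((n : ℝ) + 2)) •
        Measure.map (fun t : Fin (n + 2) → ℝ => (⟨n + 1, fun i => (x i, t i)⟩ : BasedLoop X))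
          (Measure.pi fun _ => expMeasure 1)

/-- The loop measure `μ`, the image on loops of the measure on based loops. As a discrete loop
with `p` points and multiplicity `m` consists of `p / m` based loops, its mass is the product of
the transition probabilities of its edges divided by its multiplicity. -/
def loopMeasure : Measure (Loop X) :=
  Measure.map (Quotient.mk (shiftSetoid X)) G.basedLoopMeasure

end ConductanceGraph

/-! ## Poisson point processes and jumping numbers -/

/-- `L` is a Poisson point process of intensity `ν` on the probability space `(Ω, Pr)`: a random
`ℕ ∪ {∞}`-valued measure whose values on a measurable set `A` follow the Poisson law of
parameter `ν A` (the constant `∞` if `ν A = ∞`) and whose values on disjoint sets are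
independent. -/
structure IsPoissonPointProcess {Ω E : Type*} [MeasurableSpace Ω] [MeasurableSpace E]
    (Pr : Measure Ω) (ν : Measure E) (L : Ω → Measure E) : Prop where
  measurable : Measurable L
  counting : ∀ ω A, MeasurableSet A → ∃ n : ℕ∞, L ω A = (n : ENNReal)
  poisson : ∀ A, MeasurableSet A → ν A ≠ ⊤ →
    Measure.map (fun ω => L ω A) Pr =
      Measure.map (fun n : ℕ => (n : ENNReal)) (poissonMeasure (ν A).toNNReal)
  infinite : ∀ A, MeasurableSet A → ν A = ⊤ → ∀ᵐ ω ∂Pr, L ω A = ⊤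
  indep : ∀ (m : ℕ) (A : Fin m → Set E), (∀ i, MeasurableSet (A i)) →
    Pairwise (fun i j => Disjoint (A i) (A j)) → iIndepFun (fun i ω => L ω (A i)) Pr

/-- The total number of jumps from `x` to `y` made by the loops of a point process `L`: the sum
over the loops `l` of `L ω`, with multiplicity, of the number of jumps of `l`. -/
def jumpingNumber {Ω X : Type*} [MeasurableSpace X] [DecidableEq X] (L : Ω → Measure (Loop X))
    (ω : Ω) (x y : X) : ENNReal :=
  ∫⁻ l, (Loop.jumps x y l : ENNReal) ∂(L ω)

/-! ## Eulerian networks -/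

/-- `k` is an Eulerian network on the graph `g`: an `ℕ`-valued matrix vanishing outside the
edges of `g` (hence on the diagonal) with `∑ y, k x y = ∑ y, k y x` for every `x`. -/
structure IsEulerianNetwork {X : Type*} [Fintype X] (g : SimpleGraph X) (k : Matrix X X ℕ) :
    Prop where
  eq_zero : ∀ x y, ¬ g.Adj x y → k x y = 0
  eulerian : ∀ x, ∑ y, k x y = ∑ y, k y x

/-- The number `k x = ∑ y, k x y`. -/
def vertexNumber {X : Type*} [Fintype X] (k : Matrix X X ℕ) (x : X) : ℕ := ∑ y, k x y

/-! ## The `α`-permanent -/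

/-- The number of cycles of a permutation, fixed points included. -/
def numCycles {ι : Type*} [Fintype ι] [DecidableEq ι] (σ : Equiv.Perm ι) : ℕ :=
  σ.cycleType.card + (Finset.univ.filter fun i => σ i = i).card

/-- The `α`-permanent of a square matrix. -/
def alphaPermanent {ι R : Type*} [Fintype ι] [DecidableEq ι] [CommRing R] (α : R)
    (A : Matrix ι ι R) : R :=
  ∑ σ : Equiv.Perm ι, α ^ numCycles σ * ∏ i, A i (σ i)

/-- The matrix obtained from `A` by repeating the row and the column of index `x` `m x` times. -/
def repeatMatrix {X R : Type*} (A : Matrix X X R) (m : X → ℕ) :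
    Matrix (Σ x, Fin (m x)) (Σ x, Fin (m x)) R :=
  Matrix.of fun i j => A i.1 j.1

/-- The square matrix over `X` whose entries are independent indeterminates. -/
def genericMatrix (X : Type*) : Matrix X X (MvPolynomial (X × X) ℝ) :=
  Matrix.of fun x y => MvPolynomial.X (x, y)

/-- The coefficient of `∏ P x y ^ k x y` in the `α`-permanent of the matrix obtained from `P` by
repeating `k x` times the row and the column of index `x`, the entries of `P` being considered
as indeterminates. -/
def permanentCoeff {X : Type*} [Fintype X] [DecidableEq X] (α : ℝ) (k : Matrix X X ℕ) : ℝ :=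
  MvPolynomial.coeff (Finsupp.equivFunOnFinite.symm fun e : X × X => k e.1 e.2)
    (alphaPermanent (MvPolynomial.C α) (repeatMatrix (genericMatrix X) (vertexNumber k)))

end

/-!
Only the matrix of jump numbers of a loop matters. The classes of loops with a given non zero
matrix `c` are disjoint and have finite mass `P ^ c * w c`, where `w c` is the number of based
discrete loops with steps `c` divided by their length (`loopMeasure_jumpMatrix_eq`). The numbers of
loops in these classes are therefore independent Poisson variables, and the event that the jump
numbers are `k` says that the classes below `k` occur with multiplicities adding up to `k`, while
no other loop with jumps occurs (`setOf_jumpingNumber_eq`). Its probability is thus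
`exp (-α μ(loops with jumps)) * P ^ k` times a finite sum of weights
`∏ c, (α * w c) ^ n c / (n c)!`, over the multiplicities `n` with `∑ c, n c • c = k`.

The exponential factor is `det (1 - P) ^ α`: the loops with jumps have mass
`∑_{p ≥ 2} tr (P ^ p) / p`, and `P` is conjugate to a symmetric matrix, whose eigenvalues lie in
`(-1, 1)` because the energy of the absolute value of an eigenvector is positive
(`hasSum_trace_transition_pow`).

The finite sum is the coefficient of the `α`-permanent divided by `∏ x, (k x)!`
(`coeff_permanentSeries_eq_sum`). Both sides, as functions of `k`, satisfy the same recursion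
`k x * q k = α * ∑ c, c x * w c * q (k - c)`, where `c x * w c` is the number of loops with steps
`c` that start from `x`, by rotation (`rowSum_mul_loopCount`). For the finite sum this is the
size-biasing identity of Poisson weights (`mul_sum_poissonWeight`). For the permanents it follows
the cycle of a permutation through one point of label `x`, step by step: `alphaPermanent_option`
removes one point from a permutation, which turns the open `α`-permanents, where a path from `v`
to `x` remains to be closed, into the solution of a linear system with the generic matrix
(`openPermanentSeries_expand`), and iterating this system gives the powers of that matrix.

For `α = 1` the coefficient counts the permutations of the repeated vertices with step counts `k`.
The cardinality of the stabilizer of a labelling, used twice, gives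
`(∏ x, (k x)!) ^ 2 / ∏ x, ∏ y, (k x y)!` of them (`card_perm_step_mul`).
-/

/-! ### Cycles of a permutation and expansion of the `α`-permanent -/

/-- The number of cycles is the number of orbits: a fixed point is an orbit of its own, and the
other orbits correspond to the cycle factors. -/
theorem numCycles_eq_card_quotient {ι : Type*} [Fintype ι] [DecidableEq ι] (σ : Equiv.Perm ι) :
    numCycles σ = Nat.card (Quotient (Equiv.Perm.SameCycle.setoid σ)) := by
  classical
  have hcard : numCycles σ = Nat.card (σ.cycleFactorsFinset ⊕ {i // σ i = i}) := by
    rw [Nat.card_eq_fintype_card, Fintype.card_sum, Fintype.card_coe, Fintype.card_subtype,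
      numCycles, Equiv.Perm.cycleType_def, Multiset.card_map]
    rfl
  rw [hcard]
  symm
  have hfix : ∀ x y, σ.SameCycle x y → σ x = x → x = y := by
    intro x y h hx
    exact h.eq_of_left hx
  let g : ι → σ.cycleFactorsFinset ⊕ {i // σ i = i} := fun x =>
    if h : σ x = x then Sum.inr ⟨x, h⟩
    else Sum.inl ⟨σ.cycleOf x, Equiv.Perm.cycleOf_mem_cycleFactorsFinset_iff.2
      (Equiv.Perm.mem_support.2 h)⟩
  have hg : ∀ x y, σ.SameCycle x y → g x = g y := by
    intro x y h
    by_cases hx : σ x = x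
    · rw [hfix x y h hx]
    · have hy : σ y ≠ y := fun hy => hx (by rw [← hfix y x h.symm hy, hy])
      simp only [g, hx, hy, dif_neg, not_false_eq_true]
      simp only [h.cycleOf_eq]
  refine Nat.card_congr (Equiv.ofBijective (Quotient.lift g hg) ⟨?_, ?_⟩)
  · rintro ⟨x⟩ ⟨y⟩ h
    apply Quotient.sound
    change g x = g y at h
    change σ.SameCycle x y
    by_cases hx : σ x = x <;> by_cases hy : σ y = y
    · simp only [g, hx, hy, dif_pos, Sum.inr.injEq, Subtype.mk.injEq] at h
      rw [h]
    · simp [g, hx, hy] at h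
    · simp [g, hx, hy] at h
    · simp only [g, hx, hy, dif_neg, not_false_eq_true, Sum.inl.injEq, Subtype.mk.injEq] at h
      have : x ∈ (σ.cycleOf y).support := by
        rw [← h]; simp [hx]
      exact ((Equiv.Perm.mem_support_cycleOf_iff.1 this).1).symm
  · rintro (⟨c, hc⟩ | ⟨x, hx⟩)
    · obtain ⟨x, hx, rfl⟩ : ∃ x, σ x ≠ x ∧ σ.cycleOf x = c := by
        have h1 := (Equiv.Perm.mem_cycleFactorsFinset_iff.1 hc).1
        obtain ⟨x, hx⟩ := h1.nonempty_support
        have hcx := Equiv.Perm.cycle_is_cycleOf hx hc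
        exact ⟨x, by
          have := (Equiv.Perm.mem_cycleFactorsFinset_iff.1 hc).2 x hx
          rw [← this]; exact Equiv.Perm.mem_support.1 hx, hcx.symm⟩
      exact ⟨Quotient.mk _ x, by change g x = _; simp [g, hx]⟩
    · exact ⟨Quotient.mk _ x, by change g x = _; simp [g, hx]⟩

theorem numCycles_optionCongr {ι : Type*} [Fintype ι] [DecidableEq ι] (σ : Equiv.Perm ι) :
    numCycles (Equiv.optionCongr σ) = numCycles σ + 1 := by
  have hct : Equiv.Perm.cycleType (Equiv.optionCongr σ) = σ.cycleType := by
    have h : Equiv.optionCongr σ =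
        σ.extendDomain (p := fun o : Option ι => o.isSome = true)
          (Equiv.optionIsSomeEquiv ι).symm := by
      ext1 o
      rcases o with _ | i
      · rw [Equiv.Perm.extendDomain_apply_not_subtype _ _ (by simp)]
        rfl
      · exact (Equiv.Perm.extendDomain_apply_image σ (Equiv.optionIsSomeEquiv ι).symm i).symm
    rw [h, Equiv.Perm.cycleType_extendDomain]
  have hfix : (Finset.univ.filter fun o => Equiv.optionCongr σ o = o).card =
      (Finset.univ.filter fun i => σ i = i).card + 1 := by
    rw [Finset.card_filter, Fintype.sum_option, Finset.card_filter]
    simp [add_comm]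
  rw [numCycles, hct, hfix, numCycles, add_assoc]

theorem sameCycle_of_step {ι κ : Type*} [Finite ι] {σ : Equiv.Perm ι} {τ : Equiv.Perm κ}
    {f : ι → κ} (hf : ∀ a, τ.SameCycle (f a) (f (σ a))) {a b : ι} (h : σ.SameCycle a b) :
    τ.SameCycle (f a) (f b) := by
  obtain ⟨n, -, -, rfl⟩ := h.exists_pow_eq''
  clear h
  induction n with
  | zero => exact Equiv.Perm.SameCycle.refl _ _
  | succ n ih => rw [pow_succ', Equiv.Perm.mul_apply]; exact ih.trans (hf _)

/-- Two permutations have the same number of cycles as soon as there are maps in both directions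
that send each step inside an orbit, and that are inverse to each other up to orbits. -/
theorem numCycles_eq_of_sameCycle {ι κ : Type*} [Fintype ι] [DecidableEq ι] [Fintype κ]
    [DecidableEq κ] {σ : Equiv.Perm ι} {τ : Equiv.Perm κ} (f : ι → κ) (g : κ → ι)
    (hf : ∀ a, τ.SameCycle (f a) (f (σ a))) (hg : ∀ b, σ.SameCycle (g b) (g (τ b)))
    (hgf : ∀ a, σ.SameCycle (g (f a)) a) (hfg : ∀ b, τ.SameCycle (f (g b)) b) :
    numCycles σ = numCycles τ := by
  rw [numCycles_eq_card_quotient, numCycles_eq_card_quotient]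
  exact Nat.card_congr
    { toFun := Quotient.map f fun _ _ => sameCycle_of_step hf
      invFun := Quotient.map g fun _ _ => sameCycle_of_step hg
      left_inv := by rintro ⟨a⟩; exact Quotient.sound (hgf a)
      right_inv := by rintro ⟨b⟩; exact Quotient.sound (hfg b) }

/-- Inserting a new point into a cycle, just before `j`, does not change the number of cycles. -/
theorem numCycles_swap_mul_optionCongr {ι : Type*} [Fintype ι] [DecidableEq ι] (σ : Equiv.Perm ι)
    (j : ι) : numCycles (Equiv.swap none (some j) * Equiv.optionCongr σ) = numCycles σ := by
  set τ : Equiv.Perm (Option ι) := Equiv.swap none (some j) * Equiv.optionCongr σ with hτ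
  have hnone : τ none = some j := by simp [hτ]
  have hsome : ∀ i, σ i ≠ j → τ (some i) = some (σ i) := by
    intro i hi
    simp only [hτ, Equiv.Perm.mul_apply, Equiv.optionCongr_apply, Option.map_some]
    exact Equiv.swap_apply_of_ne_of_ne (by simp) (by simpa using hi)
  have hj : ∀ i, σ i = j → τ (some i) = none := by
    intro i hi
    simp [hτ, hi]
  have hσ1 : ∀ a, σ.SameCycle a (σ a) := fun a =>
    Equiv.Perm.sameCycle_apply_right.2 (Equiv.Perm.SameCycle.refl _ _)
  have hτ1 : ∀ a, τ.SameCycle a (τ a) := fun a =>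
    Equiv.Perm.sameCycle_apply_right.2 (Equiv.Perm.SameCycle.refl _ _)
  refine numCycles_eq_of_sameCycle (fun o => o.getD j) some ?_ ?_ ?_ ?_
  · rintro (_ | i)
    · rw [hnone]
      exact Equiv.Perm.SameCycle.refl _ _
    · by_cases hi : σ i = j
      · simp only [hj i hi, Option.getD_none, Option.getD_some, ← hi]
        exact hσ1 i
      · simp only [hsome i hi, Option.getD_some]
        exact hσ1 i
  · intro i
    by_cases hi : σ i = j
    · have h1 := hτ1 (some i)
      have h2 := hτ1 none
      rw [hj i hi] at h1
      rw [hnone] at h2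
      rw [hi]; exact h1.trans h2
    · have h1 := hτ1 (some i)
      rwa [hsome i hi] at h1
  · rintro (_ | i)
    · have := (hτ1 none).symm
      rwa [hnone] at this
    · exact Equiv.Perm.SameCycle.refl _ _
  · intro i
    exact Equiv.Perm.SameCycle.refl _ _

theorem numCycles_permCongr {ι κ : Type*} [Fintype ι] [DecidableEq ι] [Fintype κ]
    [DecidableEq κ] (e : ι ≃ κ) (σ : Equiv.Perm ι) : numCycles (e.permCongr σ) = numCycles σ := by
  refine numCycles_eq_of_sameCycle e.symm e (fun b => ?_) (fun a => ?_) (fun b => ?_) fun a => ?_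
  · have : e.symm (e.permCongr σ b) = σ (e.symm b) := by simp [Equiv.permCongr_apply]
    rw [this]
    exact Equiv.Perm.sameCycle_apply_right.2 (Equiv.Perm.SameCycle.refl _ _)
  · have : e (σ a) = e.permCongr σ (e a) := by simp [Equiv.permCongr_apply]
    rw [this]
    exact Equiv.Perm.sameCycle_apply_right.2 (Equiv.Perm.SameCycle.refl _ _)
  · rw [e.apply_symm_apply]
  · rw [e.symm_apply_apply]

theorem alphaPermanent_submatrix_equiv {ι κ R : Type*} [Fintype ι] [DecidableEq ι] [Fintype κ]
    [DecidableEq κ] [CommRing R] (α : R) (e : ι ≃ κ) (A : Matrix κ κ R) :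
    alphaPermanent α (A.submatrix e e) = alphaPermanent α A := by
  refine Fintype.sum_equiv (Equiv.permCongr e) _ _ fun σ => ?_
  rw [numCycles_permCongr]
  congr 1
  refine Fintype.prod_equiv e _ _ fun i => ?_
  simp [Equiv.permCongr_apply]

/-- Expansion along a distinguished index: in a permutation it is either a fixed point, or it
precedes some `j`, and then it can be spliced out of its cycle, `j` taking its place as an image. -/
theorem alphaPermanent_option {ι R : Type*} [Fintype ι] [DecidableEq ι] [CommRing R] (α : R)
    (A : Matrix (Option ι) (Option ι) R) :
    alphaPermanent α A = α * A none none * alphaPermanent α (A.submatrix some some) +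
      ∑ j, A none (some j) * alphaPermanent α
        (Matrix.of fun i i' => if i' = j then A (some i) none else A (some i) (some i')) := by
  unfold alphaPermanent
  rw [← Equiv.sum_comp Equiv.Perm.decomposeOption.symm, Fintype.sum_prod_type, Fintype.sum_option]
  congr 1
  · rw [Finset.mul_sum]
    refine Finset.sum_congr rfl fun σ _ => ?_
    simp only [Equiv.Perm.decomposeOption_symm_apply, Equiv.swap_self]
    rw [← Equiv.Perm.one_def, one_mul, numCycles_optionCongr, Fintype.prod_option]
    simp only [Equiv.optionCongr_apply, Option.map_none, Option.map_some, Matrix.submatrix_apply]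
    ring
  · refine Finset.sum_congr rfl fun j _ => ?_
    rw [Finset.mul_sum]
    refine Finset.sum_congr rfl fun σ _ => ?_
    simp only [Equiv.Perm.decomposeOption_symm_apply]
    rw [numCycles_swap_mul_optionCongr, Fintype.prod_option]
    have : ∀ i, A (some i) ((Equiv.swap none (some j) * Equiv.optionCongr σ) (some i)) =
        (Matrix.of fun i i' =>
          if i' = j then A (some i) none else A (some i) (some i')) i (σ i) := by
      intro i
      by_cases hi : σ i = j
      · simp [hi]
      · simp only [Equiv.Perm.mul_apply, Equiv.optionCongr_apply, Option.map_some,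
          Matrix.of_apply, hi, if_false]
        rw [Equiv.swap_apply_of_ne_of_ne (by simp) (by simpa using hi)]
    have h0 : (Equiv.swap none (some j) * Equiv.optionCongr σ) none = some j := by simp
    simp only [this, h0]
    ring

/-! ### The generating series of repeated `α`-permanents -/

section Permanents

variable {X : Type*} [Fintype X]

/-- The row sums `∑ y, k (x, y)` of an exponent `k`. -/
def rowSum (k : X × X →₀ ℕ) (x : X) : ℕ := ∑ y, k (x, y)

theorem rowSum_add (k k' : X × X →₀ ℕ) : rowSum (k + k') = rowSum k + rowSum k' := by
  ext x
  simp [rowSum, Finset.sum_add_distrib]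

theorem rowSum_eq_zero_iff (k : X × X →₀ ℕ) (v : X) : rowSum k v = 0 ↔ ∀ y, k (v, y) = 0 := by
  simp [rowSum]

variable [DecidableEq X]

/-- The `α`-permanent of the generic matrix with its row and column of index `x` repeated `m x`
times. -/
noncomputable def closedPermanent (α : ℝ) (m : X → ℕ) : MvPolynomial (X × X) ℝ :=
  alphaPermanent (MvPolynomial.C α) (repeatMatrix (genericMatrix X) m)

/-- The `α`-permanent of the generic matrix with its row and column of index `y` repeated `m y`
times, bordered by one more row of index `v` and one more column of index `x`. The permutations
which it sums close a path from `v` to `x`. -/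
noncomputable def openPermanent (α : ℝ) (x v : X) (m : X → ℕ) : MvPolynomial (X × X) ℝ :=
  alphaPermanent (MvPolynomial.C α) ((genericMatrix X).submatrix
    (fun o : Option (Σ y, Fin (m y)) => o.elim v Sigma.fst)
    (fun o : Option (Σ y, Fin (m y)) => o.elim x Sigma.fst))

theorem exists_equiv_of_card_fiber_eq {ι κ β : Type*} [Fintype ι] [Fintype κ] [DecidableEq β]
    (l : ι → β) (l' : κ → β)
    (h : ∀ x, Fintype.card {i // l i = x} = Fintype.card {i // l' i = x}) :
    ∃ e : ι ≃ κ, ∀ i, l' (e i) = l i :=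
  ⟨Equiv.ofFiberEquiv fun x => Fintype.equivOfCardEq (h x), fun i => Equiv.ofFiberEquiv_map _ i⟩

theorem card_fiber_sigma_fst (m : X → ℕ) (x : X) :
    Fintype.card {i : Σ y, Fin (m y) // i.1 = x} = m x := by
  rw [Fintype.card_subtype, Finset.card_filter, Fintype.sum_sigma,
    Finset.sum_eq_single x]
  · simp
  · intro y _ hy
    simp [hy]
  · simp

theorem card_fiber_option_sigma_fst (m : X → ℕ) (v x : X) :
    Fintype.card {o : Option (Σ y, Fin (m y)) // o.elim v Sigma.fst = x} =
      m x + Pi.single (M := fun _ => ℕ) v 1 x := by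
  have h := card_fiber_sigma_fst m x
  rw [Fintype.card_subtype, Finset.card_filter] at h
  rw [Fintype.card_subtype, Finset.card_filter, Fintype.sum_option, add_comm]
  refine congrArg₂ _ h ?_
  rw [Pi.single_apply]
  exact if_congr eq_comm rfl rfl

/-- Singling out a point of label `y`. -/
theorem exists_equiv_option_sigma (m : X → ℕ) (j : Σ y, Fin (m y)) :
    ∃ e : (Σ y, Fin (m y)) ≃ Option (Σ y, Fin ((m - Pi.single j.1 1 : X → ℕ) y)),
      e j = none ∧ ∀ i, (e i).elim j.1 Sigma.fst = i.1 := by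
  have hj : 0 < m j.1 := lt_of_le_of_lt (Nat.zero_le _) j.2.2
  obtain ⟨e, he⟩ := exists_equiv_of_card_fiber_eq
    (fun i : Σ y, Fin (m y) => i.1)
    (fun o : Option (Σ y, Fin ((m - Pi.single j.1 1 : X → ℕ) y)) => o.elim j.1 Sigma.fst) (by
      intro x
      rw [card_fiber_sigma_fst, card_fiber_option_sigma_fst, Pi.sub_apply]
      by_cases hx : x = j.1
      · subst hx
        simp only [Pi.single_eq_same]
        omega
      · simp [Pi.single_eq_of_ne hx])
  have h0 : (e.symm none).1 = j.1 := by
    rw [← he]; simp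
  refine ⟨(Equiv.swap j (e.symm none)).trans e, by simp, fun i => ?_⟩
  rw [Equiv.trans_apply, he]
  by_cases h1 : i = j
  · rw [h1, Equiv.swap_apply_left, h0]
  by_cases h2 : i = e.symm none
  · rw [h2, Equiv.swap_apply_right, h0]
  rw [Equiv.swap_apply_of_ne_of_ne h1 h2]

theorem closedPermanent_eq_openPermanent (α : ℝ) (m : X → ℕ) (x : X) (hx : 0 < m x) :
    closedPermanent α m = openPermanent α x x (m - Pi.single x 1) := by
  obtain ⟨e, -, he⟩ := exists_equiv_option_sigma m ⟨x, ⟨0, hx⟩⟩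
  rw [openPermanent, ← alphaPermanent_submatrix_equiv _ e, closedPermanent]
  congr 1
  ext1 i j
  simp only [Matrix.submatrix_apply, he]
  rfl

/-- The first step of the path from `v` to `x` either ends it, or goes to one of the remaining
points, of some label `y`. -/
theorem openPermanent_expand (α : ℝ) (x v : X) (m : X → ℕ) :
    openPermanent α x v m = MvPolynomial.C α * MvPolynomial.X (v, x) * closedPermanent α m +
      ∑ y, (m y : MvPolynomial (X × X) ℝ) *
        (MvPolynomial.X (v, y) * openPermanent α x y (m - Pi.single y 1)) := by
  rw [openPermanent, alphaPermanent_option]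
  congr 1
  rw [Fintype.sum_sigma]
  refine Finset.sum_congr rfl fun y _ => ?_
  rw [Finset.sum_congr rfl (g := fun _ => MvPolynomial.X (v, y) *
    openPermanent α x y (m - Pi.single y 1)), Finset.sum_const, Finset.card_univ, Fintype.card_fin,
    nsmul_eq_mul]
  intro a _
  obtain ⟨e, he0, he⟩ := exists_equiv_option_sigma m ⟨y, a⟩
  congr 1
  rw [openPermanent, ← alphaPermanent_submatrix_equiv _ e]
  congr 1
  ext1 i j
  simp only [Matrix.submatrix_apply, he, Matrix.of_apply]
  by_cases hj : j = ⟨y, a⟩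
  · subst hj
    simp [he0]
  · rw [if_neg hj]
    have h1 : e j ≠ none := fun h => hj (e.injective (h.trans he0.symm))
    have h2 := he j
    obtain ⟨p, hp⟩ := Option.ne_none_iff_exists'.1 h1
    rw [hp] at h2 ⊢
    simp only [Option.elim_some] at h2 ⊢
    rw [h2]

theorem coeff_alphaPermanent_submatrix {ι Y : Type*} [Fintype ι] [DecidableEq ι] [DecidableEq Y]
    (α : ℝ) (l l' : ι → Y) (k : Y × Y →₀ ℕ) :
    MvPolynomial.coeff k (alphaPermanent (MvPolynomial.C α) ((genericMatrix Y).submatrix l l')) =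
      ∑ σ : Equiv.Perm ι,
        if ∑ i, Finsupp.single (l i, l' (σ i)) 1 = k then α ^ numCycles σ else 0 := by
  rw [alphaPermanent, MvPolynomial.coeff_sum]
  refine Finset.sum_congr rfl fun σ _ => ?_
  have : ∏ i, (genericMatrix Y).submatrix l l' i (σ i) =
      MvPolynomial.monomial (∑ i, Finsupp.single (l i, l' (σ i)) 1) (1 : ℝ) := by
    rw [MvPolynomial.monomial_sum_one]
    rfl
  rw [this, ← map_pow, MvPolynomial.coeff_C_mul, MvPolynomial.coeff_monomial]
  simp

theorem rowSum_single (v y : X) :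
    rowSum (Finsupp.single (v, y) 1) = Pi.single (M := fun _ => ℕ) v 1 := by
  ext x
  by_cases h : x = v
  · subst h
    simp [rowSum, Finsupp.single_apply]
  · rw [Pi.single_eq_of_ne h]
    simp [rowSum, Ne.symm h]

theorem rowSum_sum_single {ι : Type*} [Fintype ι] (l l' : ι → X) (x : X) :
    rowSum (∑ i, Finsupp.single (l i, l' i) 1) x = Fintype.card {i // l i = x} := by
  rw [Fintype.card_subtype, Finset.card_filter]
  have : ∀ s : Finset ι, rowSum (∑ i ∈ s, Finsupp.single (l i, l' i) 1) x =
      ∑ i ∈ s, if l i = x then 1 else 0 := by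
    intro s
    classical
    induction s using Finset.induction_on with
    | empty => simp [rowSum]
    | insert a s ha ih =>
      rw [Finset.sum_insert ha, Finset.sum_insert ha, rowSum_add, Pi.add_apply, ih, rowSum_single,
        Pi.single_apply]
      simp [eq_comm]
  exact this _

theorem coeff_openPermanent_eq_zero (α : ℝ) (x v : X) (m : X → ℕ) (k : X × X →₀ ℕ)
    (hk : rowSum k v = 0) : MvPolynomial.coeff k (openPermanent α x v m) = 0 := by
  rw [openPermanent, coeff_alphaPermanent_submatrix]
  refine Finset.sum_eq_zero fun σ _ => if_neg ?_
  rintro rfl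
  rw [rowSum_sum_single, card_fiber_option_sigma_fst] at hk
  simp at hk

/-- The exponential generating series of the coefficients of repeated `α`-permanents. -/
noncomputable def permanentSeries (X : Type*) [Fintype X] [DecidableEq X] (α : ℝ) :
    MvPowerSeries (X × X) ℝ := fun k =>
  MvPolynomial.coeff k (closedPermanent α (rowSum k)) / ∏ x, ((rowSum k x).factorial : ℝ)

/-- The exponential generating series of the coefficients of open `α`-permanents. -/
noncomputable def openPermanentSeries (α : ℝ) (x v : X) : MvPowerSeries (X × X) ℝ := fun k =>
  MvPolynomial.coeff k (openPermanent α x v (rowSum k - Pi.single v 1)) /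
    ∏ y, (((rowSum k - Pi.single v 1 : X → ℕ) y).factorial : ℝ)

theorem prod_factorial_sub_single (m : X → ℕ) (y : X) (hy : 0 < m y) :
    ∏ x, ((m x).factorial : ℝ) =
      m y * ∏ x, (((m - Pi.single y 1 : X → ℕ) x).factorial : ℝ) := by
  obtain ⟨m', hm'⟩ : ∃ m' : X → ℕ, m' = m - Pi.single y 1 := ⟨_, rfl⟩
  rw [← hm', ← Finset.mul_prod_erase _ (fun x => ((m x).factorial : ℝ)) (Finset.mem_univ y),
    ← Finset.mul_prod_erase _ (fun x => ((m' x).factorial : ℝ)) (Finset.mem_univ y), ← mul_assoc]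
  congr 1
  · rw [hm', Pi.sub_apply, Pi.single_eq_same]
    exact_mod_cast (Nat.mul_factorial_pred hy.ne').symm
  · refine Finset.prod_congr rfl fun x hx => ?_
    rw [hm', Pi.sub_apply, Pi.single_eq_of_ne (Finset.ne_of_mem_erase hx), Nat.sub_zero]

theorem coeff_permanentSeries (α : ℝ) (k : X × X →₀ ℕ) :
    MvPowerSeries.coeff k (permanentSeries X α) =
      MvPolynomial.coeff k (closedPermanent α (rowSum k)) / ∏ x, ((rowSum k x).factorial : ℝ) :=
  rfl

theorem coeff_openPermanentSeries (α : ℝ) (x v : X) (k : X × X →₀ ℕ) :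
    MvPowerSeries.coeff k (openPermanentSeries α x v) =
      MvPolynomial.coeff k (openPermanent α x v (rowSum k - Pi.single v 1)) /
        ∏ y, (((rowSum k - Pi.single v 1 : X → ℕ) y).factorial : ℝ) :=
  rfl

theorem rowSum_mul_coeff_permanentSeries (α : ℝ) (x : X) (k : X × X →₀ ℕ) :
    (rowSum k x : ℝ) * MvPowerSeries.coeff k (permanentSeries X α) =
      MvPowerSeries.coeff k (openPermanentSeries α x x) := by
  rw [coeff_permanentSeries, coeff_openPermanentSeries]
  rcases Nat.eq_zero_or_pos (rowSum k x) with h | h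
  · rw [coeff_openPermanent_eq_zero _ _ _ _ _ h, h]
    simp
  · rw [closedPermanent_eq_openPermanent α _ x h, prod_factorial_sub_single _ x h]
    have : (rowSum k x : ℝ) ≠ 0 := by exact_mod_cast h.ne'
    field_simp

theorem rowSum_sub_single (k : X × X →₀ ℕ) (v y : X) (h : k (v, y) ≠ 0) :
    rowSum (k - Finsupp.single (v, y) 1) = rowSum k - Pi.single v 1 := by
  have hle : Finsupp.single (v, y) 1 ≤ k := by
    rw [Finsupp.single_le_iff]; omega
  conv_rhs => rw [← tsub_add_cancel_of_le hle, rowSum_add, rowSum_single]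
  ext; simp

theorem coeff_X_mul_series {s : Type*} [DecidableEq s] (i : s) (φ : MvPowerSeries s ℝ)
    (k : s →₀ ℕ) :
    MvPowerSeries.coeff k (MvPowerSeries.X i * φ) =
      if k i = 0 then 0 else MvPowerSeries.coeff (k - Finsupp.single i 1) φ := by
  rw [MvPowerSeries.X_def, MvPowerSeries.coeff_monomial_mul, one_mul]
  simp only [Finsupp.single_le_iff]
  split_ifs <;> first | rfl | omega

theorem openPermanentSeries_expand (α : ℝ) (x v : X) :
    openPermanentSeries α x v =
      MvPowerSeries.C α * (MvPowerSeries.X (v, x) * permanentSeries X α) +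
        ∑ y, MvPowerSeries.X (v, y) * openPermanentSeries α x y := by
  ext k
  rw [map_add, map_sum, MvPowerSeries.coeff_C_mul]
  simp only [coeff_X_mul_series]
  rw [coeff_openPermanentSeries]
  rcases Nat.eq_zero_or_pos (rowSum k v) with h | h
  · have h' := (rowSum_eq_zero_iff k v).1 h
    rw [coeff_openPermanent_eq_zero _ _ _ _ _ h]
    simp [h']
  rw [openPermanent_expand, MvPolynomial.coeff_add, MvPolynomial.coeff_sum, add_div,
    Finset.sum_div]
  set m : X → ℕ := rowSum k - Pi.single v 1 with hm
  congr 1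
  · rw [mul_assoc, MvPolynomial.coeff_C_mul, MvPolynomial.coeff_X_mul', mul_div_assoc]
    congr 1
    by_cases hx : k (v, x) = 0
    · simp [hx]
    · rw [if_pos (Finsupp.mem_support_iff.2 hx), if_neg hx]
      rw [coeff_permanentSeries, rowSum_sub_single _ _ _ hx]
  · refine Finset.sum_congr rfl fun y _ => ?_
    rw [← map_natCast (MvPolynomial.C (σ := X × X) (R := ℝ)), MvPolynomial.coeff_C_mul,
      MvPolynomial.coeff_X_mul']
    by_cases hx : k (v, y) = 0
    · simp [hx]
    · rw [if_pos (Finsupp.mem_support_iff.2 hx), if_neg hx]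
      rw [coeff_openPermanentSeries, rowSum_sub_single _ _ _ hx, ← hm]
      rcases Nat.eq_zero_or_pos (m y) with h0 | h0
      · rw [coeff_openPermanent_eq_zero _ _ _ _ (k - Finsupp.single (v, y) 1), h0]
        · simp
        · rw [rowSum_sub_single _ _ _ hx, ← hm, h0]
      · rw [prod_factorial_sub_single _ y h0]
        have : (m y : ℝ) ≠ 0 := by exact_mod_cast h0.ne'
        field_simp

end Permanents

/-! ### Paths, discrete loops and powers of matrices -/

section Loops

variable {X : Type*} [Fintype X] [DecidableEq X]

/-- The exponent counting the steps of a cyclic sequence: its value at `(x, y)` is the number of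
`i` with `ω i = x` and `ω (i + 1) = y`. -/
noncomputable def loopType {X : Type*} {n : ℕ} (ω : Fin (n + 1) → X) : X × X →₀ ℕ :=
  ∑ i, Finsupp.single (ω i, ω (i + 1)) 1

theorem pow_succ_apply_eq_sum_path {R : Type*} [CommSemiring R] (A : Matrix X X R) (n : ℕ)
    (v x : X) :
    (A ^ (n + 1)) v x = ∑ ω : Fin (n + 1) → X, if ω 0 = v then
      (∏ i : Fin n, A (ω i.castSucc) (ω i.succ)) * A (ω (Fin.last n)) x else 0 := by
  induction n generalizing v with
  | zero =>
    rw [← (Equiv.funUnique (Fin 1) X).symm.sum_comp]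
    simp
  | succ n ih =>
    rw [pow_succ', Matrix.mul_apply, ← (Fin.consEquiv fun _ : Fin (n + 2) => X).sum_comp,
      Fintype.sum_prod_type]
    symm
    rw [Finset.sum_eq_single v]
    · have : ∀ ω : Fin (n + 1) → X,
          (if (Fin.consEquiv fun _ : Fin (n + 2) => X) (v, ω) 0 = v then
            (∏ i : Fin (n + 1), A ((Fin.consEquiv fun _ : Fin (n + 2) => X) (v, ω) i.castSucc)
              ((Fin.consEquiv fun _ : Fin (n + 2) => X) (v, ω) i.succ)) *
              A ((Fin.consEquiv fun _ : Fin (n + 2) => X) (v, ω) (Fin.last (n + 1))) x else 0) =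
          A v (ω 0) * ((∏ i : Fin n, A (ω i.castSucc) (ω i.succ)) * A (ω (Fin.last n)) x) := by
        intro ω
        have h1 : ∀ i : Fin (n + 1), (Fin.consEquiv fun _ : Fin (n + 2) => X) (v, ω) i.succ = ω i :=
          fun i => Fin.cons_succ (α := fun _ => X) v ω i
        have h0 : (Fin.consEquiv fun _ : Fin (n + 2) => X) (v, ω) 0 = v :=
          Fin.cons_zero (α := fun _ => X) v ω
        rw [if_pos h0, Fin.prod_univ_succ, ← Fin.succ_last]
        simp only [Fin.castSucc_zero, h0, h1, ← Fin.succ_castSucc]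
        ring
      rw [Finset.sum_congr rfl fun ω _ => this ω]
      simp_rw [ih, Finset.mul_sum]
      rw [Finset.sum_comm]
      refine Finset.sum_congr rfl fun ω _ => ?_
      rw [Finset.sum_eq_single (ω 0)]
      · simp
      · intro y _ hy
        rw [if_neg (Ne.symm hy), mul_zero]
      · simp
    · intro y _ hy
      refine Finset.sum_eq_zero fun ω _ => if_neg ?_
      exact fun h => hy ((Fin.cons_zero (α := fun _ => X) y ω).symm.trans h)
    · simp

theorem pow_succ_apply_self {R : Type*} [CommSemiring R] (A : Matrix X X R) (n : ℕ) (x : X) :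
    (A ^ (n + 1)) x x = ∑ ω : Fin (n + 1) → X, if ω 0 = x then
      ∏ i, A (ω i) (ω (i + 1)) else 0 := by
  rw [pow_succ_apply_eq_sum_path]
  refine Finset.sum_congr rfl fun ω _ => ?_
  split_ifs with h
  · rw [Fin.prod_univ_castSucc (n := n)]
    congr 1
    · refine Finset.prod_congr rfl fun i _ => ?_
      rw [Fin.coeSucc_eq_succ]
    · rw [Fin.last_add_one, h]
  · rfl

theorem trace_pow_succ {R : Type*} [CommSemiring R] (A : Matrix X X R) (n : ℕ) :
    (A ^ (n + 1)).trace = ∑ ω : Fin (n + 1) → X, ∏ i, A (ω i) (ω (i + 1)) := by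
  simp only [Matrix.trace, Matrix.diag_apply, pow_succ_apply_self]
  rw [Finset.sum_comm]
  simp

/-- The number of cyclic sequences of `n + 1` points with step counts `k`. -/
noncomputable def loopCount (n : ℕ) (k : X × X →₀ ℕ) : ℕ :=
  (Finset.univ.filter fun ω : Fin (n + 1) → X => loopType ω = k).card

/-- The number of cyclic sequences of `n + 1` points that start from `x` with step counts `k`. -/
noncomputable def loopCountFrom (x : X) (n : ℕ) (k : X × X →₀ ℕ) : ℕ :=
  (Finset.univ.filter fun ω : Fin (n + 1) → X => ω 0 = x ∧ loopType ω = k).card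

theorem loopType_shift {X : Type*} {n : ℕ} (ω : Fin (n + 1) → X) (s : Fin (n + 1)) :
    loopType (fun i => ω (i + s)) = loopType ω := by
  unfold loopType
  rw [← Equiv.sum_comp (Equiv.addRight s) fun i => Finsupp.single (ω i, ω (i + 1)) 1]
  refine Finset.sum_congr rfl fun i _ => ?_
  simp only [Equiv.coe_addRight]
  rw [add_right_comm]

theorem degree_loopType {X : Type*} {n : ℕ} (ω : Fin (n + 1) → X) :
    (loopType ω).degree = n + 1 := by
  simp [loopType, map_sum]

/-- Rotating a loop lets each of its visits to `x` become its starting point. -/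
theorem rowSum_mul_loopCount (x : X) (n : ℕ) (k : X × X →₀ ℕ) :
    rowSum k x * loopCount n k = (n + 1) * loopCountFrom x n k := by
  have h1 : rowSum k x * loopCount n k =
      ∑ ω : Fin (n + 1) → X, ∑ i, if ω i = x ∧ loopType ω = k then 1 else 0 := by
    rw [loopCount, Finset.card_filter, Finset.mul_sum]
    refine Finset.sum_congr rfl fun ω _ => ?_
    by_cases h : loopType ω = k
    · rw [if_pos h, mul_one]
      conv_lhs => rw [← h, loopType, rowSum_sum_single, Fintype.card_subtype, Finset.card_filter]
      simp [h]
    · simp [h]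
  rw [h1, Finset.sum_comm, Finset.sum_congr rfl (g := fun _ => loopCountFrom x n k)]
  · simp
  · intro i _
    rw [loopCountFrom, Finset.card_filter,
      ← Equiv.sum_comp ((Equiv.addRight i).arrowCongr (Equiv.refl X))]
    refine Finset.sum_congr rfl fun ω _ => if_congr ?_ rfl rfl
    have h2 : (Equiv.addRight i).arrowCongr (Equiv.refl X) ω = fun j => ω (j + -i) := rfl
    rw [h2, loopType_shift]
    simp only [add_neg_cancel]

theorem loopCountFrom_eq_zero (x : X) (n : ℕ) (k : X × X →₀ ℕ) (h : k.degree ≠ n + 1) :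
    loopCountFrom x n k = 0 := by
  rw [loopCountFrom, Finset.card_eq_zero, Finset.filter_eq_empty_iff]
  rintro ω - ⟨-, rfl⟩
  exact h (degree_loopType ω)

theorem loopCount_eq_zero (n : ℕ) (k : X × X →₀ ℕ) (h : k.degree ≠ n + 1) :
    loopCount n k = 0 := by
  rw [loopCount, Finset.card_eq_zero, Finset.filter_eq_empty_iff]
  rintro ω - rfl
  exact h (degree_loopType ω)

/-- The mass given to the exponent `k` by the measure on discrete based loops in which a loop with
`p` points has mass `1 / p`. Only loops with `k.degree` points have step counts `k`; the value at
`k = 0` is `0`. -/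
noncomputable def loopWeight (k : X × X →₀ ℕ) : ℝ := loopCount (k.degree - 1) k / k.degree

/-- The generic matrix with entries in power series. -/
noncomputable def stepMatrix (X : Type*) : Matrix X X (MvPowerSeries (X × X) ℝ) :=
  Matrix.of fun x y => MvPowerSeries.X (x, y)

theorem coeff_stepMatrix_pow_self (n : ℕ) (x : X) (k : X × X →₀ ℕ) :
    MvPowerSeries.coeff k ((stepMatrix X ^ (n + 1)) x x) = loopCountFrom x n k := by
  rw [pow_succ_apply_self, map_sum, loopCountFrom, Finset.card_filter, Nat.cast_sum]
  refine Finset.sum_congr rfl fun ω _ => ?_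
  have : ∏ i, stepMatrix X (ω i) (ω (i + 1)) =
      MvPowerSeries.monomial (loopType ω) (1 : ℝ) := by
    have h2 : MvPowerSeries.monomial (loopType ω) (1 : ℝ) =
        ((MvPolynomial.monomial (loopType ω) (1 : ℝ) : MvPolynomial (X × X) ℝ) :
          MvPowerSeries (X × X) ℝ) := (MvPolynomial.coe_monomial _ _).symm
    rw [h2, loopType, MvPolynomial.monomial_sum_one,
      ← MvPolynomial.coeToMvPowerSeries.ringHom_apply,
      map_prod]
    refine Finset.prod_congr rfl fun i _ => ?_
    exact (MvPolynomial.coe_X _).symm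
  by_cases h : ω 0 = x
  · simp [h, this, MvPowerSeries.coeff_monomial, eq_comm]
  · simp [h]

theorem coeff_sum_stepMatrix_pow (x : X) (k : X × X →₀ ℕ) (K : ℕ) (hK : k.degree ≤ K) :
    MvPowerSeries.coeff k (∑ n ∈ Finset.range K, (stepMatrix X ^ (n + 1)) x x) =
      rowSum k x * loopWeight k := by
  rw [map_sum]
  simp only [coeff_stepMatrix_pow_self]
  rcases Nat.eq_zero_or_pos k.degree with h | h
  · rw [Finset.sum_eq_zero]
    · simp [loopWeight, h]
    · intro n _
      rw [loopCountFrom_eq_zero _ _ _ (by omega), Nat.cast_zero]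
  · rw [Finset.sum_eq_single (k.degree - 1)]
    · have h1 := rowSum_mul_loopCount x (k.degree - 1) k
      rw [Nat.sub_add_cancel h] at h1
      have h2 : (rowSum k x : ℝ) * loopCount (k.degree - 1) k =
        k.degree * loopCountFrom x (k.degree - 1) k := by exact_mod_cast h1
      rw [loopWeight, ← mul_div_assoc, h2]
      have : (k.degree : ℝ) ≠ 0 := by exact_mod_cast h.ne'
      field_simp
    · intro n _ hn
      rw [loopCountFrom_eq_zero _ _ _ (by omega), Nat.cast_zero]
    · intro hn
      exact absurd (Finset.mem_range.2 (by omega)) hn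

/-- Each factor of the step matrix raises the degree by one. -/
theorem coeff_stepMatrix_pow_mul_eq_zero (K : ℕ) (v x : X) (φ : MvPowerSeries (X × X) ℝ)
    (k : X × X →₀ ℕ) (hk : k.degree < K) :
    MvPowerSeries.coeff k ((stepMatrix X ^ K) v x * φ) = 0 := by
  induction K generalizing k v with
  | zero => omega
  | succ K ih =>
    rw [pow_succ', Matrix.mul_apply, Finset.sum_mul, map_sum]
    refine Finset.sum_eq_zero fun y _ => ?_
    rw [mul_assoc]
    change MvPowerSeries.coeff k (MvPowerSeries.X (v, y) * _) = 0
    rw [coeff_X_mul_series]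
    split_ifs with h
    · rfl
    · apply ih
      have hle : Finsupp.single (v, y) 1 ≤ k := by
        rw [Finsupp.single_le_iff]; omega
      have := congrArg Finsupp.degree (tsub_add_cancel_of_le hle)
      rw [map_add, Finsupp.degree_single] at this
      omega

/-- The first `K` steps of the linear system solved by the open permanents; the remainder consists
of the paths that are still open after `K` steps. -/
theorem openPermanentSeries_iterate (α : ℝ) (x v : X) (K : ℕ) :
    openPermanentSeries α x v = MvPowerSeries.C α *
      ((∑ n ∈ Finset.range K, (stepMatrix X ^ (n + 1)) v x) * permanentSeries X α) +
        ∑ y, (stepMatrix X ^ K) v y * openPermanentSeries α x y := by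
  induction K with
  | zero => simp [Matrix.one_apply]
  | succ K ih =>
    rw [ih, Finset.sum_range_succ, add_mul, mul_add, add_assoc]
    congr 1
    have : ∀ y, (stepMatrix X ^ K) v y * openPermanentSeries α x y =
        MvPowerSeries.C α * ((stepMatrix X ^ K) v y * stepMatrix X y x * permanentSeries X α) +
          ∑ z, (stepMatrix X ^ K) v y * stepMatrix X y z * openPermanentSeries α x z := by
      intro y
      conv_lhs => rw [openPermanentSeries_expand, mul_add, Finset.mul_sum]
      simp only [stepMatrix, Matrix.of_apply]
      congr 1
      · ring
      · exact Finset.sum_congr rfl fun z _ => (mul_assoc _ _ _).symm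
    rw [Finset.sum_congr rfl fun y _ => this y, Finset.sum_add_distrib, ← Finset.mul_sum,
      ← Finset.sum_mul, Finset.sum_comm]
    simp only [pow_succ, Matrix.mul_apply, Finset.sum_mul]

/-- The recursion that determines the coefficients of repeated `α`-permanents: the cycle through
a given point of label `x` is a loop from `x` to `x`. -/
theorem rowSum_mul_coeff_permanentSeries_eq_sum (α : ℝ) (x : X) (k : X × X →₀ ℕ) :
    (rowSum k x : ℝ) * MvPowerSeries.coeff k (permanentSeries X α) =
      ∑ p ∈ Finset.HasAntidiagonal.antidiagonal k, α * (rowSum p.1 x * loopWeight p.1) *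
        MvPowerSeries.coeff p.2 (permanentSeries X α) := by
  rw [rowSum_mul_coeff_permanentSeries, openPermanentSeries_iterate α x x (k.degree + 1), map_add,
    map_sum, Finset.sum_eq_zero fun y _ => coeff_stepMatrix_pow_mul_eq_zero _ _ _ _ _ (by omega),
    add_zero, MvPowerSeries.coeff_C_mul, MvPowerSeries.coeff_mul, Finset.mul_sum]
  refine Finset.sum_congr rfl fun p hp => ?_
  rw [Finset.HasAntidiagonal.mem_antidiagonal] at hp
  have hle : p.1.degree ≤ k.degree + 1 := by
    rw [← hp, map_add]
    omega
  rw [coeff_sum_stepMatrix_pow _ _ _ hle]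
  ring

end Loops

/-! ### Compound sums and the exponential formula -/

section Compound

variable {ι M : Type*} [Fintype ι] [DecidableEq ι]

/-- The families of multiplicities at most `K` for which the objects of sizes `c i` add up to
`k`. -/
noncomputable def multiplicities {s : Type*} [DecidableEq s] (c : ι → s →₀ ℕ) (K : ℕ)
    (k : s →₀ ℕ) : Finset (ι → ℕ) :=
  (Fintype.piFinset fun _ => Finset.range (K + 1)).filter fun n => ∑ i, n i • c i = k

variable {s : Type*} [DecidableEq s]

theorem mem_multiplicities {c : ι → s →₀ ℕ} (hc : ∀ i, c i ≠ 0) {K : ℕ} {k : s →₀ ℕ}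
    (hk : k.degree ≤ K) {n : ι → ℕ} : n ∈ multiplicities c K k ↔ ∑ i, n i • c i = k := by
  rw [multiplicities, Finset.mem_filter, and_iff_right_iff_imp, Fintype.mem_piFinset]
  rintro h i
  have h1 : n i * (c i).degree ≤ k.degree := by
    rw [← h, map_sum]
    simp only [map_nsmul, smul_eq_mul]
    exact Finset.single_le_sum (f := fun i => n i * (c i).degree) (fun _ _ => Nat.zero_le _)
      (Finset.mem_univ i)
  have h2 : 0 < (c i).degree := by
    rw [Nat.pos_iff_ne_zero, Ne, Finsupp.degree_eq_zero_iff]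
    exact hc i
  rw [Finset.mem_range]
  nlinarith

/-- The weight of the multiplicities `n` under independent (unnormalised) Poisson laws. -/
noncomputable def poissonWeight (a : ι → ℝ) (n : ι → ℕ) : ℝ := ∏ i, a i ^ n i / (n i).factorial

theorem natCast_mul_poissonWeight_add_single (a : ι → ℝ) (n : ι → ℕ) (i : ι) :
    ((n i + 1 : ℕ) : ℝ) * poissonWeight a (n + Pi.single i 1) = a i * poissonWeight a n := by
  unfold poissonWeight
  rw [← Finset.mul_prod_erase _ _ (Finset.mem_univ i),
    ← Finset.mul_prod_erase _ (fun j => a j ^ n j / ((n j).factorial : ℝ)) (Finset.mem_univ i),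
    ← mul_assoc, ← mul_assoc]
  congr 1
  · rw [Pi.add_apply, Pi.single_eq_same, pow_succ, Nat.factorial_succ]
    push_cast
    have : ((n i).factorial : ℝ) ≠ 0 := by positivity
    field_simp
  · refine Finset.prod_congr rfl fun j hj => ?_
    rw [Pi.add_apply, Pi.single_eq_of_ne (Finset.ne_of_mem_erase hj), add_zero]

theorem sum_add_single_smul {s : Type*} (c : ι → s →₀ ℕ) (n : ι → ℕ) (i : ι) :
    ∑ j, (n + Pi.single i 1 : ι → ℕ) j • c j = ∑ j, n j • c j + c i := by
  simp only [Pi.add_apply, add_smul, Finset.sum_add_distrib]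
  congr 1
  rw [Finset.sum_eq_single i]
  · simp
  · intro j _ hj
    simp [Pi.single_eq_of_ne hj]
  · simp

/-- The size-biased form of the compound sum at `i`: removing one object of size `c i`. -/
theorem sum_mul_poissonWeight (c : ι → s →₀ ℕ) (hc : ∀ i, c i ≠ 0) (a : ι → ℝ) {K : ℕ}
    {k : s →₀ ℕ} (hk : k.degree ≤ K) (i : ι) :
    ∑ n ∈ multiplicities c K k, (n i : ℝ) * poissonWeight a n =
      if c i ≤ k then a i * ∑ n ∈ multiplicities c K (k - c i), poissonWeight a n else 0 := by
  split_ifs with hle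
  · have hk' : (k - c i).degree ≤ K := by
      have := congrArg Finsupp.degree (tsub_add_cancel_of_le hle)
      rw [map_add] at this
      omega
    rw [Finset.mul_sum]
    symm
    refine Finset.sum_of_injOn (fun n => n + Pi.single i 1) ?_ ?_ ?_ ?_
    · intro n _ n' _ h
      exact add_right_cancel h
    · intro n hn
      rw [Finset.mem_coe, mem_multiplicities hc hk'] at hn
      rw [Finset.mem_coe, mem_multiplicities hc hk, sum_add_single_smul, hn,
        tsub_add_cancel_of_le hle]
    · intro n hn hn'
      rw [mem_multiplicities hc hk] at hn
      rcases Nat.eq_zero_or_pos (n i) with h0 | h0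
      · simp [h0]
      · refine absurd ⟨n - Pi.single i 1, ?_, ?_⟩ hn'
        · have h1 : n - Pi.single i 1 + Pi.single i 1 = n := by
            ext j
            by_cases hj : j = i
            · subst hj; simp; omega
            · simp [Pi.single_eq_of_ne hj]
          rw [Finset.mem_coe, mem_multiplicities hc hk']
          rw [← h1, sum_add_single_smul] at hn
          rw [← hn, add_tsub_cancel_right]
        · ext j
          by_cases hj : j = i
          · subst hj; simp; omega
          · simp [Pi.single_eq_of_ne hj]
    · intro n _
      rw [← natCast_mul_poissonWeight_add_single]
      simp
  · refine Finset.sum_eq_zero fun n hn => ?_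
    rw [mem_multiplicities hc hk] at hn
    rcases Nat.eq_zero_or_pos (n i) with h0 | h0
    · simp [h0]
    · refine absurd ?_ hle
      rw [← hn]
      calc c i ≤ n i • c i := by
            intro e
            simpa using Nat.le_mul_of_pos_left (c i e) h0
        _ ≤ _ := Finset.single_le_sum (f := fun j => n j • c j) (fun _ _ => bot_le)
            (Finset.mem_univ i)

/-- The recursion that determines compound sums, for an additive functional `φ` of the size. -/
theorem mul_sum_poissonWeight (c : ι → s →₀ ℕ) (hc : ∀ i, c i ≠ 0) (a : ι → ℝ) {K : ℕ}
    {k : s →₀ ℕ} (hk : k.degree ≤ K) (φ : (s →₀ ℕ) →+ ℕ) :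
    (φ k : ℝ) * ∑ n ∈ multiplicities c K k, poissonWeight a n =
      ∑ i, if c i ≤ k then
        φ (c i) * a i * ∑ n ∈ multiplicities c K (k - c i), poissonWeight a n else 0 := by
  rw [Finset.mul_sum]
  have : ∀ n ∈ multiplicities c K k, (φ k : ℝ) * poissonWeight a n =
      ∑ i, (φ (c i) : ℝ) * (n i * poissonWeight a n) := by
    intro n hn
    rw [mem_multiplicities hc hk] at hn
    rw [← hn, map_sum, Nat.cast_sum, Finset.sum_mul]
    refine Finset.sum_congr rfl fun i _ => ?_
    rw [map_nsmul, smul_eq_mul]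
    push_cast
    ring
  rw [Finset.sum_congr rfl this, Finset.sum_comm]
  refine Finset.sum_congr rfl fun i _ => ?_
  rw [← Finset.mul_sum, sum_mul_poissonWeight c hc a hk]
  split_ifs
  · ring
  · simp

end Compound

section Exponential

/-- The non zero exponents below `k`. -/
noncomputable def properParts {s : Type*} [DecidableEq s] (k : s →₀ ℕ) : Finset (s →₀ ℕ) :=
  (Finset.Iic k).erase 0

theorem ne_zero_of_mem_properParts {s : Type*} [DecidableEq s] {k : s →₀ ℕ} (c : properParts k) :
    c.1 ≠ 0 :=
  (Finset.mem_erase.1 c.2).1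

variable {X : Type*} [Fintype X] [DecidableEq X]

/-- The row sum of index `x`, as an additive functional. -/
def rowSumHom (x : X) : (X × X →₀ ℕ) →+ ℕ where
  toFun k := rowSum k x
  map_zero' := by simp [rowSum]
  map_add' k k' := by rw [rowSum_add, Pi.add_apply]

theorem coeff_zero_permanentSeries (α : ℝ) :
    MvPowerSeries.coeff 0 (permanentSeries X α) = 1 := by
  have h0 : rowSum (0 : X × X →₀ ℕ) = 0 := by ext; simp [rowSum]
  rw [coeff_permanentSeries, h0, closedPermanent]
  have : IsEmpty (Σ x, Fin ((0 : X → ℕ) x)) := ⟨fun i => i.2.elim0⟩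
  have h1 := coeff_alphaPermanent_submatrix α (Sigma.fst : (Σ x, Fin ((0 : X → ℕ) x)) → X)
    Sigma.fst 0
  have h2 : repeatMatrix (genericMatrix X) 0 = (genericMatrix X).submatrix
    (Sigma.fst : (Σ x, Fin ((0 : X → ℕ) x)) → X) Sigma.fst := rfl
  rw [h2, h1]
  simp [numCycles]

/-- The exponential formula: the coefficient of a repeated `α`-permanent sums, over the ways to
write `k` as a sum of step counts of loops, the Poisson weights of intensity `α` times the loop
weights. -/
theorem coeff_permanentSeries_eq_sum (α : ℝ) (k : X × X →₀ ℕ) :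
    MvPowerSeries.coeff k (permanentSeries X α) =
      ∑ n ∈ multiplicities (fun c : properParts k => c.1) k.degree k,
        poissonWeight (fun c : properParts k => α * loopWeight c.1) n := by
  have hc : ∀ c : properParts k, c.1 ≠ 0 := ne_zero_of_mem_properParts
  -- Both sides satisfy the same recursion, for every exponent below the fixed `k`.
  suffices h : ∀ N, ∀ j ≤ k, j.degree = N → MvPowerSeries.coeff j (permanentSeries X α) =
      ∑ n ∈ multiplicities (fun c : properParts k => c.1) k.degree j,
        poissonWeight (fun c : properParts k => α * loopWeight c.1) n from h _ k le_rfl rfl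
  intro N
  induction N using Nat.strong_induction_on with
  | _ N ih =>
  rintro j hjk rfl
  have hdeg : j.degree ≤ k.degree := Finsupp.degree_mono hjk
  by_cases hj : j = 0
  · subst hj
    rw [coeff_zero_permanentSeries, Finset.sum_eq_single 0]
    · simp [poissonWeight]
    · intro n hn hn0
      rw [mem_multiplicities hc hdeg] at hn
      refine absurd (funext fun i => ?_) hn0
      have h1 := (Finset.sum_eq_zero_iff.1 hn) i (Finset.mem_univ i)
      exact (smul_eq_zero.1 h1).resolve_right (hc i)
    · intro h
      refine absurd ?_ h
      rw [mem_multiplicities hc hdeg]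
      simp
  · obtain ⟨x, hx⟩ : ∃ x, rowSum j x ≠ 0 := by
      by_contra! h
      refine hj (Finsupp.ext fun e => ?_)
      exact (rowSum_eq_zero_iff j e.1).1 (h e.1) e.2
    have hx' : (rowSum j x : ℝ) ≠ 0 := by exact_mod_cast hx
    apply mul_left_cancel₀ hx'
    have h1 := mul_sum_poissonWeight (fun c : properParts k => c.1) hc
      (fun c => α * loopWeight c.1) hdeg (rowSumHom x)
    change (rowSum j x : ℝ) * _ = _ at h1
    rw [h1, rowSum_mul_coeff_permanentSeries_eq_sum]
    have h2 : ∀ c : X × X →₀ ℕ, c ≠ 0 → c ≤ j →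
        MvPowerSeries.coeff (j - c) (permanentSeries X α) =
          ∑ n ∈ multiplicities (fun c : properParts k => c.1) k.degree (j - c),
            poissonWeight (fun c : properParts k => α * loopWeight c.1) n := by
      intro c hc0 hcj
      refine ih _ ?_ _ (tsub_le_self.trans hjk) rfl
      have h3 := congrArg Finsupp.degree (tsub_add_cancel_of_le hcj)
      rw [map_add] at h3
      have h4 : c.degree ≠ 0 := fun h => hc0 ((Finsupp.degree_eq_zero_iff _).1 h)
      omega
    let G : (X × X →₀ ℕ) → ℝ := fun c => if c ≤ j then α * (rowSum c x * loopWeight c) *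
      MvPowerSeries.coeff (j - c) (permanentSeries X α) else 0
    have h3 : ∀ c : properParts k, (if c.1 ≤ j then
        (rowSumHom x c.1 : ℝ) * (α * loopWeight c.1) *
          ∑ n ∈ multiplicities (fun c : properParts k => c.1) k.degree (j - c.1),
            poissonWeight (fun c : properParts k => α * loopWeight c.1) n else 0) =
        G c.1 := by
      intro c
      simp only [G]
      split_ifs with hcj
      · rw [h2 _ (hc c) hcj]
        change (rowSum c.1 x : ℝ) * _ * _ = _
        ring
      · rfl
    rw [Finset.sum_congr rfl fun c _ => h3 c, Finset.sum_coe_sort (properParts k) G,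
      ← Finset.sum_filter]
    have h4 : ∑ p ∈ Finset.HasAntidiagonal.antidiagonal j, α * (rowSum p.1 x * loopWeight p.1) *
        MvPowerSeries.coeff p.2 (permanentSeries X α) =
        ∑ c ∈ Finset.Iic j, α * (rowSum c x * loopWeight c) *
          MvPowerSeries.coeff (j - c) (permanentSeries X α) := by
      refine Finset.sum_bij' (fun p _ => p.1) (fun c _ => (c, j - c)) ?_ ?_ ?_ ?_ ?_
      · intro p hp
        rw [Finset.HasAntidiagonal.mem_antidiagonal] at hp
        rw [Finset.mem_Iic, ← hp]
        exact le_self_add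
      · intro c hcj
        rw [Finset.HasAntidiagonal.mem_antidiagonal]
        exact add_tsub_cancel_of_le (Finset.mem_Iic.1 hcj)
      · intro p hp
        rw [Finset.HasAntidiagonal.mem_antidiagonal] at hp
        rw [← hp, add_tsub_cancel_left]
      · intro c _
        rfl
      · intro p hp
        rw [Finset.HasAntidiagonal.mem_antidiagonal] at hp
        rw [← hp, add_tsub_cancel_left]
    rw [h4]
    symm
    refine Finset.sum_subset ?_ ?_
    · intro c hcm
      exact Finset.mem_Iic.2 (Finset.mem_filter.1 hcm).2
    · intro c hcj hcn
      have : c = 0 := by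
        by_contra h
        refine hcn (Finset.mem_filter.2 ⟨Finset.mem_erase.2 ⟨h, ?_⟩, Finset.mem_Iic.1 hcj⟩)
        exact Finset.mem_Iic.2 ((Finset.mem_Iic.1 hcj).trans hjk)
      subst this
      simp [rowSum]

end Exponential

/-! ### Permutations with prescribed step counts -/

section Counting

/-- The permutations that transport the labelling `g` to `f` form a coset of the group preserving
`f`. -/
theorem card_perm_comp_eq {ι β : Type*} [Fintype ι] [DecidableEq ι] [Fintype β] [DecidableEq β]
    (f g : ι → β) (h : ∀ x, Fintype.card {i // g i = x} = Fintype.card {i // f i = x}) :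
    (Finset.univ.filter fun σ : Equiv.Perm ι => ∀ i, f (σ i) = g i).card =
      ∏ x, (Fintype.card {i // f i = x}).factorial := by
  obtain ⟨e, he⟩ := exists_equiv_of_card_fiber_eq g f h
  rw [← DomMulAct.stabilizer_card f, Fintype.card_subtype]
  refine Finset.card_equiv (Equiv.mulRight e⁻¹) fun σ => ?_
  simp only [Finset.mem_filter, Finset.mem_univ, true_and, funext_iff, Function.comp_apply,
    Equiv.coe_mulRight, Equiv.Perm.mul_apply]
  constructor
  · intro h i
    rw [h, ← he]
    exact congrArg f (e.apply_symm_apply i)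
  · intro h i
    have := h (e i)
    rw [he] at this
    rw [← this]
    exact congrArg (fun j => f (σ j)) (e.symm_apply_apply i).symm

variable {X : Type*} [Fintype X] [DecidableEq X]

theorem sum_single_apply {ι s : Type*} [Fintype ι] [DecidableEq s] (l : ι → s) (e : s) :
    (∑ i, Finsupp.single (l i) 1 : s →₀ ℕ) e = Fintype.card {i // l i = e} := by
  rw [Finsupp.finsetSum_apply, Fintype.card_subtype, Finset.card_filter]
  exact Finset.sum_congr rfl fun i _ => Finsupp.single_apply

theorem card_fiber_snd {ι : Type*} [Fintype ι] (l g : ι → X) (y : X) :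
    Fintype.card {i // g i = y} = ∑ x, Fintype.card {i // (l i, g i) = (x, y)} := by
  simp only [Fintype.card_subtype, Finset.card_filter]
  rw [Finset.sum_comm]
  refine Finset.sum_congr rfl fun i _ => ?_
  by_cases h : g i = y <;> simp [h]

/-- The number of permutations with step counts `k`, for an Eulerian `k`. It is found by counting
twice the pairs of a labelling `g` of the points with the right numbers of labels and of a
permutation which transports it. -/
theorem card_perm_step_mul (k : X × X →₀ ℕ) (hk : ∀ x, rowSum k x = ∑ y, k (y, x)) :
    (Finset.univ.filter fun σ : Equiv.Perm (Σ x, Fin (rowSum k x)) =>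
        ∑ i, Finsupp.single (i.1, (σ i).1) 1 = k).card * ∏ e, (k e).factorial =
      (∏ x, (rowSum k x).factorial) ^ 2 := by
  set ι := Σ x, Fin (rowSum k x)
  let l : ι → X := Sigma.fst
  have hl : ∀ x, Fintype.card {i // l i = x} = rowSum k x := card_fiber_sigma_fst (rowSum k)
  -- the labellings `g` such that there are `k (x, y)` points with labels `(x, y)`
  let S : Finset (ι → X) := Finset.univ.filter fun g => ∑ i, Finsupp.single (l i, g i) 1 = k
  have hS : ∀ g, g ∈ S ↔ ∀ e, Fintype.card {i // (l i, g i) = e} = k e := by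
    intro g
    simp only [S, Finset.mem_filter, Finset.mem_univ, true_and, Finsupp.ext_iff, sum_single_apply]
  have hSl : ∀ g ∈ S, ∀ x, Fintype.card {i // g i = x} = Fintype.card {i // l i = x} := by
    intro g hg x
    rw [card_fiber_snd l g, hl, hk]
    exact Finset.sum_congr rfl fun y _ => (hS g).1 hg _
  have h1 : (Finset.univ.filter fun σ : Equiv.Perm ι =>
      ∑ i, Finsupp.single (i.1, (σ i).1) 1 = k).card = S.card * ∏ x, (rowSum k x).factorial := by
    rw [Finset.card_eq_sum_card_fiberwise (f := fun σ : Equiv.Perm ι => fun i => l (σ i)) (t := S)]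
    · rw [Finset.sum_const_nat (m := ∏ x, (rowSum k x).factorial)]
      intro g hg
      have h2 := card_perm_comp_eq l g (hSl g hg)
      simp only [hl] at h2
      rw [← h2, Finset.filter_filter]
      congr 1
      ext σ
      simp only [Finset.mem_filter, Finset.mem_univ, true_and, funext_iff]
      refine and_iff_right_of_imp fun h => ?_
      have h3 := (Finset.mem_filter.1 hg).2
      exact (Finset.sum_congr rfl fun i _ => by rw [← h i]).trans h3
    · intro σ hσ
      have := (Finset.mem_filter.1 (Finset.mem_coe.1 hσ)).2
      exact Finset.mem_coe.2 (Finset.mem_filter.2 ⟨Finset.mem_univ _, this⟩)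
  have h2 : S.card * ∏ e, (k e).factorial = ∏ x, (rowSum k x).factorial := by
    obtain ⟨e0, he0⟩ := exists_equiv_of_card_fiber_eq l
      (fun i : Σ e : X × X, Fin (k e) => i.1.1) (by
        intro x
        rw [hl, Fintype.card_subtype, Finset.card_filter, Fintype.sum_sigma, Fintype.sum_prod_type,
          Finset.sum_eq_single x]
        · simp [rowSum]
        · intro y _ hy
          simp [hy]
        · simp)
    let g0 : ι → X := fun i => (e0 i).1.2
    have hg0 : g0 ∈ S := by
      rw [hS]
      intro e
      have h5 := card_fiber_sigma_fst (fun e => k e) e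
      rw [← h5]
      refine Fintype.card_congr (Equiv.subtypeEquiv e0 fun i => ?_)
      rw [← he0]
    have h3 : (Finset.univ.filter fun σ : Equiv.Perm ι => ∀ i, l (σ i) = l i).card =
        ∏ x, (rowSum k x).factorial := by
      have := card_perm_comp_eq l l fun _ => rfl
      simpa only [hl] using this
    rw [← h3, Finset.card_eq_sum_card_fiberwise (f := fun σ : Equiv.Perm ι => fun i => g0 (σ i))
      (t := S)]
    · rw [Finset.sum_const_nat (m := ∏ e, (k e).factorial)]
      intro g hg
      have h4 := card_perm_comp_eq (fun i => (l i, g0 i)) (fun i => (l i, g i)) (by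
        intro e
        rw [(hS g).1 hg, (hS g0).1 hg0])
      simp only [(hS g0).1 hg0] at h4
      rw [← h4, Finset.filter_filter]
      congr 1
      ext σ
      simp only [Finset.mem_filter, Finset.mem_univ, true_and, funext_iff, Prod.mk.injEq,
        forall_and]
    · intro σ hσ
      have h4 := (Finset.mem_filter.1 (Finset.mem_coe.1 hσ)).2
      rw [Finset.mem_coe, hS]
      intro e
      rw [← (hS g0).1 hg0 e]
      refine Fintype.card_congr (Equiv.subtypeEquiv σ fun i => ?_)
      rw [h4]
  rw [h1, mul_right_comm, h2, sq]

theorem coeff_closedPermanent_one_mul (k : X × X →₀ ℕ) (hk : ∀ x, rowSum k x = ∑ y, k (y, x)) :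
    MvPolynomial.coeff k (closedPermanent 1 (rowSum k)) * ∏ e, ((k e).factorial : ℝ) =
      (∏ x, ((rowSum k x).factorial : ℝ)) ^ 2 := by
  have h := coeff_alphaPermanent_submatrix 1 (Sigma.fst : (Σ x, Fin (rowSum k x)) → X)
    Sigma.fst k
  have h2 : repeatMatrix (genericMatrix X) (rowSum k) = (genericMatrix X).submatrix
    (Sigma.fst : (Σ x, Fin (rowSum k x)) → X) Sigma.fst := rfl
  have h3 := card_perm_step_mul k hk
  rw [closedPermanent, h2, h]
  rw [← Nat.cast_prod, ← Nat.cast_prod, ← Nat.cast_pow, ← h3, Nat.cast_mul, Finset.card_filter,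
    Nat.cast_sum]
  congr 1
  refine Finset.sum_congr rfl fun σ _ => ?_
  rw [one_pow]
  split_ifs <;> simp

end Counting

/-! ### The spectrum of the transition matrix -/

namespace ConductanceGraph

variable {X : Type*} [Fintype X] (G : ConductanceGraph X)

theorem energy_eq (f : X → ℝ) :
    G.energy f = ∑ x, G.dualityMeasure x * f x ^ 2 - ∑ x, ∑ y, G.cond x y * (f x * f y) := by
  have h1 : ∑ x, ∑ y, G.cond x y * f y ^ 2 = ∑ x, ∑ y, G.cond x y * f x ^ 2 := by
    rw [Finset.sum_comm]
    exact Finset.sum_congr rfl fun x _ => Finset.sum_congr rfl fun y _ => by rw [G.cond_symm]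
  have h2 : ∑ x, ∑ y, G.cond x y * (f x - f y) ^ 2 =
      ∑ x, ∑ y, G.cond x y * f x ^ 2 + ∑ x, ∑ y, G.cond x y * f y ^ 2 -
        2 * ∑ x, ∑ y, G.cond x y * (f x * f y) := by
    simp only [Finset.mul_sum, ← Finset.sum_add_distrib, ← Finset.sum_sub_distrib]
    exact Finset.sum_congr rfl fun x _ => Finset.sum_congr rfl fun y _ => by ring
  have h3 : ∑ x, G.dualityMeasure x * f x ^ 2 =
      ∑ x, ∑ y, G.cond x y * f x ^ 2 + ∑ x, G.kill x * f x ^ 2 := by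
    simp only [dualityMeasure, add_mul, Finset.sum_mul, Finset.sum_add_distrib]
  rw [energy, h2, h1, h3]
  ring

variable {G}

theorem cond_self {X : Type*} {G : ConductanceGraph X} (x : X) : G.cond x x = 0 :=
  G.cond_eq_zero _ _ (SimpleGraph.irrefl _)

theorem transition_self (x : X) : G.transition x x = 0 := by
  simp [transition, cond_self]

theorem dualityMeasure_pos [DecidableEq X] (hG : G.IsTransient) (x : X) :
    0 < G.dualityMeasure x := by
  have h := hG (Pi.single x 1) (by simp)
  rw [energy_eq] at h
  simpa [Pi.single_apply, cond_self] using h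

theorem transition_nonneg (x y : X) : 0 ≤ G.transition x y :=
  div_nonneg (G.cond_nonneg x y)
    (add_nonneg (Finset.sum_nonneg fun z _ => G.cond_nonneg x z) (G.kill_nonneg x))

variable (G) in
/-- The symmetric matrix `C x y / √(λ x λ y)`, which is conjugate to the transition matrix. -/
noncomputable def symmTransition : Matrix X X ℝ :=
  Matrix.of fun x y => G.cond x y / (√(G.dualityMeasure x) * √(G.dualityMeasure y))

theorem isHermitian_symmTransition : G.symmTransition.IsHermitian := by
  ext x y
  simp [symmTransition, G.cond_symm x y, mul_comm]

variable [DecidableEq X]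

/-- Conjugation by the diagonal matrix of the `√(λ x)` makes the transition matrix symmetric. -/
theorem exists_transition_eq_conj (hG : G.IsTransient) :
    ∃ U : (Matrix X X ℝ)ˣ, G.transition = (↑U⁻¹ : Matrix X X ℝ) * G.symmTransition * U := by
  have h : ∀ x, √(G.dualityMeasure x) ≠ 0 := fun x =>
    (Real.sqrt_pos.2 (dualityMeasure_pos hG x)).ne'
  refine ⟨⟨Matrix.diagonal fun x => √(G.dualityMeasure x),
    Matrix.diagonal fun x => (√(G.dualityMeasure x))⁻¹, ?_, ?_⟩, ?_⟩
  · rw [Matrix.diagonal_mul_diagonal]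
    simp [h]
  · rw [Matrix.diagonal_mul_diagonal]
    simp [h]
  · ext x y
    simp only [Units.inv_mk, Matrix.mul_diagonal, Matrix.diagonal_mul]
    rw [transition, symmTransition, Matrix.of_apply, Matrix.of_apply]
    have := h x
    have := h y
    have h2 := Real.mul_self_sqrt (dualityMeasure_pos hG x).le
    conv_lhs => rw [← h2]
    field_simp

/-- Transience applied to the absolute value of an eigenvector bounds both signs at once. -/
theorem abs_eigenvalue_lt_one (hG : G.IsTransient) (f : X → ℝ) (hf : f ≠ 0) (μ : ℝ)
    (h : G.symmTransition.mulVec f = μ • f) : |μ| < 1 := by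
  have hs : ∀ x, √(G.dualityMeasure x) ≠ 0 := fun x =>
    (Real.sqrt_pos.2 (dualityMeasure_pos hG x)).ne'
  have hpos : 0 < ∑ x, f x ^ 2 := by
    obtain ⟨x, hx⟩ := Function.ne_iff.1 hf
    exact Finset.sum_pos' (fun _ _ => sq_nonneg _) ⟨x, Finset.mem_univ x, by
      have : f x ≠ 0 := hx
      positivity⟩
  have hE := hG (fun x => |f x| / √(G.dualityMeasure x)) (by
    obtain ⟨x, hx⟩ := Function.ne_iff.1 hf
    exact Function.ne_iff.2 ⟨x, div_ne_zero (abs_ne_zero.2 hx) (hs x)⟩)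
  rw [energy_eq] at hE
  have h1 : ∑ x, G.dualityMeasure x * (|f x| / √(G.dualityMeasure x)) ^ 2 = ∑ x, f x ^ 2 := by
    refine Finset.sum_congr rfl fun x _ => ?_
    rw [div_pow, sq_abs, Real.sq_sqrt (dualityMeasure_pos hG x).le]
    field_simp [(dualityMeasure_pos hG x).ne']
  have h2 : ∀ x y, G.cond x y *
      (|f x| / √(G.dualityMeasure x) * (|f y| / √(G.dualityMeasure y))) =
      |f x * (G.symmTransition x y * f y)| := by
    intro x y
    have h3 : 0 ≤ G.symmTransition x y := div_nonneg (G.cond_nonneg x y) (by positivity)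
    rw [abs_mul, abs_mul, abs_of_nonneg h3, symmTransition, Matrix.of_apply]
    have := hs x
    have := hs y
    field_simp
  simp only [h1, h2] at hE
  have h4 : |μ| * ∑ x, f x ^ 2 ≤ ∑ x, ∑ y, |f x * (G.symmTransition x y * f y)| := by
    have h5 : μ * ∑ x, f x ^ 2 = ∑ x, ∑ y, f x * (G.symmTransition x y * f y) := by
      rw [Finset.mul_sum]
      refine Finset.sum_congr rfl fun x _ => ?_
      have := congrFun h x
      rw [Matrix.mulVec, dotProduct, Pi.smul_apply, smul_eq_mul] at this
      rw [← Finset.mul_sum, this]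
      ring
    rw [← abs_of_pos hpos, ← abs_mul, h5]
    exact (Finset.abs_sum_le_sum_abs _ _).trans
      (Finset.sum_le_sum fun x _ => Finset.abs_sum_le_sum_abs _ _)
  by_contra hμ
  have : 1 * ∑ x, f x ^ 2 ≤ |μ| * ∑ x, f x ^ 2 := by
    gcongr
    exact not_lt.1 hμ
  linarith

/-- The transition matrix is diagonalisable with eigenvalues in `(-1, 1)`. -/
theorem exists_eigenvalues (hG : G.IsTransient) :
    ∃ e : X → ℝ, (∀ i, |e i| < 1) ∧ (∀ n, (G.transition ^ n).trace = ∑ i, e i ^ n) ∧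
      (1 - G.transition).det = ∏ i, (1 - e i) := by
  obtain ⟨U, hU⟩ := exists_transition_eq_conj hG
  have hA := isHermitian_symmTransition (G := G)
  refine ⟨hA.eigenvalues, fun i => ?_, fun n => ?_, ?_⟩
  · refine abs_eigenvalue_lt_one hG (hA.eigenvectorBasis i) ?_ _ (hA.mulVec_eigenvectorBasis i)
    intro h
    exact hA.eigenvectorBasis.orthonormal.ne_zero i (by ext x; exact congrFun h x)
  · rw [hU, Units.conj_pow', Matrix.trace_units_conj']
    conv_lhs => rw [hA.spectral_theorem]
    rw [← map_pow, Matrix.diagonal_pow, Unitary.conjStarAlgAut_apply, Matrix.trace_mul_cycle]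
    simp
  · have h1 : 1 - G.transition = (↑U⁻¹ : Matrix X X ℝ) * (1 - G.symmTransition) * U := by
      rw [hU, mul_sub, sub_mul]
      simp
    rw [h1, Matrix.det_units_conj']
    conv_lhs => rw [hA.spectral_theorem]
    have h2 : (1 : Matrix X X ℝ) = Unitary.conjStarAlgAut ℝ _ hA.eigenvectorUnitary 1 :=
      (map_one _).symm
    conv_lhs => rw [h2]
    rw [← map_sub, ← Matrix.diagonal_one, Matrix.diagonal_sub, Unitary.conjStarAlgAut_apply,
      Matrix.det_mul_comm, ← mul_assoc, Unitary.coe_star_mul_self, one_mul, Matrix.det_diagonal]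
    rfl

theorem det_one_sub_transition_pos (hG : G.IsTransient) : 0 < (1 - G.transition).det := by
  obtain ⟨e, he, -, h⟩ := exists_eigenvalues hG
  rw [h]
  exact Finset.prod_pos fun i _ => sub_pos.2 (abs_lt.1 (he i)).2

/-- The mass of the non trivial loops. There is no loop with one step, as the trace of the
transition matrix is zero. -/
theorem hasSum_trace_transition_pow (hG : G.IsTransient) :
    HasSum (fun n : ℕ => (G.transition ^ (n + 2)).trace / ((n : ℝ) + 2))
      (-Real.log (1 - G.transition).det) := by
  obtain ⟨e, he, ht, hd⟩ := exists_eigenvalues hG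
  have h1 : HasSum (fun n : ℕ => ∑ i, e i ^ (n + 1) / ((n : ℝ) + 1))
      (∑ i, -Real.log (1 - e i)) :=
    hasSum_sum fun i _ => Real.hasSum_pow_div_log_of_abs_lt_one (he i)
  have h0 : ∑ i, e i = 0 := by
    have := ht 1
    simp only [pow_one] at this
    rw [← this, Matrix.trace]
    exact Finset.sum_eq_zero fun x _ => transition_self x
  rw [← hasSum_nat_add_iff' 1] at h1
  have h2 : (fun n : ℕ => (G.transition ^ (n + 2)).trace / ((n : ℝ) + 2)) =
      fun n : ℕ => ∑ i, e i ^ (n + 1 + 1) / (((n + 1 : ℕ) : ℝ) + 1) := by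
    funext n
    rw [ht, Finset.sum_div]
    refine Finset.sum_congr rfl fun i _ => ?_
    push_cast
    rw [add_assoc, one_add_one_eq_two, add_assoc, one_add_one_eq_two]
  have h3 : -Real.log (1 - G.transition).det = ∑ i, -Real.log (1 - e i) -
      ∑ n ∈ Finset.range 1, ∑ i, e i ^ (n + 1) / ((n : ℝ) + 1) := by
    rw [hd, Real.log_prod fun i _ => (sub_pos.2 (abs_lt.1 (he i)).2).ne']
    simp [h0]
  rw [h2, h3]
  exact h1

end ConductanceGraph

/-! ### The loop measure of the loops with given numbers of jumps -/

section LoopMeasure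

theorem measurable_of_sigma {ι β : Type*} {α : ι → Type*} [∀ i, MeasurableSpace (α i)]
    [MeasurableSpace β] {f : (Σ i, α i) → β} (h : ∀ i, Measurable fun a => f ⟨i, a⟩) :
    Measurable f := fun _ hs => MeasurableSpace.measurableSet_iInf.2 fun i => h i hs

theorem measurable_sigmaMk {ι : Type*} {α : ι → Type*} [∀ i, MeasurableSpace (α i)] (i : ι) :
    Measurable (Sigma.mk i : α i → Σ i, α i) := fun _ hs =>
  MeasurableSpace.measurableSet_iInf.1 hs i

/-- The matrix of the numbers of jumps of a loop. -/
def Loop.jumpMatrix {X : Type*} [DecidableEq X] (l : Loop X) (e : X × X) : ℕ :=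
  Loop.jumps e.1 e.2 l

variable {X : Type*} [Fintype X] [DecidableEq X]

theorem measurable_basedLoop_jumps [MeasurableSpace X] [DiscreteMeasurableSpace X] (x y : X) :
    Measurable (BasedLoop.jumps x y : BasedLoop X → ℕ) := by
  refine measurable_of_sigma fun n => ?_
  simp only [BasedLoop.jumps, Finset.card_filter]
  change Measurable fun w : Fin (n + 1) → X × ℝ => ∑ i : Fin (n + 1),
    if x ≠ y ∧ (w i).1 = x ∧ (w (i + 1)).1 = y then 1 else 0
  refine Finset.measurable_fun_sum _ fun i _ => ?_
  refine Measurable.ite ?_ measurable_const measurable_const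
  have h1 : ∀ (j : Fin (n + 1)) (z : X),
      MeasurableSet {w : Fin (n + 1) → X × ℝ | (w j).1 = z} := fun j z =>
    (measurable_fst.comp (measurable_pi_apply j)) (MeasurableSet.singleton z)
  exact (MeasurableSet.const _).inter ((h1 i x).inter (h1 (i + 1) y))

theorem measurable_loop_jumps [MeasurableSpace X] [DiscreteMeasurableSpace X] (x y : X) :
    Measurable (Loop.jumps x y : Loop X → ℕ) :=
  measurable_from_quotient.2 (measurable_basedLoop_jumps x y)

theorem measurable_jumpMatrix [MeasurableSpace X] [DiscreteMeasurableSpace X] :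
    Measurable (Loop.jumpMatrix : Loop X → X × X → ℕ) :=
  measurable_pi_lambda _ fun e => measurable_loop_jumps e.1 e.2

/-- The loops with one point, which carry the infinite part of the loop measure, do not jump. -/
theorem jumpMatrix_mk_zero {X : Type*} [DecidableEq X] (w : Fin 1 → X × ℝ) :
    Loop.jumpMatrix (Quotient.mk (shiftSetoid X) ⟨0, w⟩) = 0 := by
  ext e
  change BasedLoop.jumps e.1 e.2 ⟨0, w⟩ = 0
  rw [BasedLoop.jumps, Finset.card_eq_zero, Finset.filter_eq_empty_iff]
  rintro i - ⟨hne, h1, h2⟩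
  apply hne
  change (w i).1 = e.1 at h1
  change (w (i + 1)).1 = e.2 at h2
  rw [← h1, ← h2]
  exact congrArg (fun j : Fin 1 => (w j).1) (Subsingleton.elim (α := Fin 1) _ _)

/-- Where no step of the based loop stays put, the jumps are all the steps. -/
theorem jumpMatrix_mk_eq_loopType {X : Type*} [DecidableEq X] {n : ℕ} (x : Fin (n + 1) → X)
    (t : Fin (n + 1) → ℝ) (h : ∀ i, x i ≠ x (i + 1)) :
    Loop.jumpMatrix (Quotient.mk (shiftSetoid X) ⟨n, fun i => (x i, t i)⟩) = ⇑(loopType x) := by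
  ext e
  change BasedLoop.jumps e.1 e.2 ⟨n, fun i => (x i, t i)⟩ = _
  rw [loopType, sum_single_apply, Fintype.card_subtype, BasedLoop.jumps]
  congr 1
  ext i
  simp only [Finset.mem_filter, Finset.mem_univ, true_and]
  constructor
  · rintro ⟨-, h1, h2⟩
    exact Prod.ext h1 h2
  · rintro rfl
    exact ⟨h i, rfl, rfl⟩

namespace ConductanceGraph

variable [MeasurableSpace X] [DiscreteMeasurableSpace X] {G : ConductanceGraph X}

theorem ne_of_prod_transition_ne_zero {X : Type*} [Fintype X] {G : ConductanceGraph X} {n : ℕ}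
    {x : Fin (n + 1) → X} (h : ∏ i, G.transition (x i) (x (i + 1)) ≠ 0) (i : Fin (n + 1)) :
    x i ≠ x (i + 1) := by
  intro hi
  refine h (Finset.prod_eq_zero (Finset.mem_univ i) ?_)
  rw [← hi, transition_self]

variable (G) in
/-- A set of loops which is defined by the numbers of jumps and contains no loop without jumps
only sees the discrete loops with at least two points. -/
theorem loopMeasure_preimage_jumpMatrix (D : Set (X × X → ℕ)) (hD : (0 : X × X → ℕ) ∉ D) :
    G.loopMeasure (Loop.jumpMatrix ⁻¹' D) =
      ∑' n : ℕ, ∑ x : Fin (n + 2) → X,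
        ENNReal.ofReal ((∏ i, G.transition (x i) (x (i + 1))) / ((n : ℝ) + 2)) *
          D.indicator 1 ⇑(loopType x) := by
  have hDm : MeasurableSet D := D.to_countable.measurableSet
  have hm : MeasurableSet (Loop.jumpMatrix ⁻¹' D : Set (Loop X)) := measurable_jumpMatrix hDm
  have hq : Measurable (Quotient.mk (shiftSetoid X)) := measurable_quotient_mk''
  rw [loopMeasure, Measure.map_apply hq hm, basedLoopMeasure, Measure.add_apply,
    Measure.finsetSum_apply, Measure.sum_apply _ (hq hm)]
  have h0 : ∀ x : X, Measure.map (fun t : ℝ => (⟨0, fun _ => (x, t)⟩ : BasedLoop X))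
      ((volume.restrict (Set.Ioi (0 : ℝ))).withDensity
        fun t => ENNReal.ofReal (Real.exp (-t) / t))
      (Quotient.mk (shiftSetoid X) ⁻¹' (Loop.jumpMatrix ⁻¹' D)) = 0 := by
    intro x
    rw [Measure.map_apply _ (hq hm)]
    · refine (congrArg _ ?_).trans measure_empty
      ext t
      simp only [Set.mem_preimage, jumpMatrix_mk_zero, hD, Set.mem_empty_iff_false]
    · exact (measurable_sigmaMk (α := fun n => Fin (n + 1) → X × ℝ) 0).comp
        (measurable_pi_lambda _ fun _ => measurable_const.prodMk measurable_id)
  rw [Finset.sum_eq_zero fun x _ => h0 x, zero_add]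
  refine tsum_congr fun n => ?_
  rw [Measure.finsetSum_apply]
  refine Finset.sum_congr rfl fun x _ => ?_
  rw [Measure.smul_apply, smul_eq_mul]
  by_cases hx : ∏ i, G.transition (x i) (x (i + 1)) = 0
  · simp [hx]
  congr 1
  rw [Measure.map_apply _ (hq hm)]
  · have h1 : ∀ t : Fin (n + 2) → ℝ,
        Loop.jumpMatrix (Quotient.mk (shiftSetoid X) ⟨n + 1, fun i => (x i, t i)⟩) =
          ⇑(loopType x) :=
      fun t => jumpMatrix_mk_eq_loopType x t (ne_of_prod_transition_ne_zero hx)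
    have : IsProbabilityMeasure (expMeasure 1) := isProbabilityMeasure_expMeasure one_pos
    by_cases h : ⇑(loopType x) ∈ D
    · rw [Set.indicator_of_mem h]
      refine (congrArg _ ?_).trans
        (measure_univ (μ := Measure.pi fun _ : Fin (n + 2) => expMeasure 1))
      ext t
      simp only [Set.mem_preimage, h1, h, Set.mem_univ]
    · rw [Set.indicator_of_notMem h]
      refine (congrArg _ ?_).trans measure_empty
      ext t
      simp only [Set.mem_preimage, h1, h, Set.mem_empty_iff_false]
  · exact (measurable_sigmaMk (α := fun n => Fin (n + 1) → X × ℝ) (n + 1)).comp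
      (measurable_pi_lambda _ fun i => measurable_const.prodMk (measurable_pi_apply i))

theorem prod_transition_nonneg {X : Type*} [Fintype X] {G : ConductanceGraph X} {n : ℕ}
    (x : Fin (n + 1) → X) : 0 ≤ ∏ i, G.transition (x i) (x (i + 1)) :=
  Finset.prod_nonneg fun _ _ => transition_nonneg _ _

/-- The product of the transition probabilities to the powers `c`. -/
noncomputable def stepProd {X : Type*} [Fintype X] (G : ConductanceGraph X) (c : X × X →₀ ℕ) : ℝ :=
  ∏ e, G.transition e.1 e.2 ^ c e

theorem stepProd_nonneg {X : Type*} [Fintype X] {G : ConductanceGraph X} (c : X × X →₀ ℕ) :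
    0 ≤ G.stepProd c :=
  Finset.prod_nonneg fun _ _ => pow_nonneg (transition_nonneg _ _) _

theorem prod_transition_eq_stepProd {X : Type*} [Fintype X] {G : ConductanceGraph X} {n : ℕ}
    (x : Fin (n + 1) → X) :
    ∏ i, G.transition (x i) (x (i + 1)) = G.stepProd (loopType x) := by
  simp only [stepProd, loopType, Finsupp.finsetSum_apply]
  simp only [← Finset.prod_pow_eq_pow_sum]
  rw [Finset.prod_comm]
  refine Finset.prod_congr rfl fun i _ => ?_
  classical
  rw [Finset.prod_eq_single (x i, x (i + 1))]
  · simp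
  · intro e _ he
    rw [Finsupp.single_eq_of_ne he, pow_zero]
  · simp

/-- The loops with jump numbers `c` have mass `stepProd c * loopWeight c`. -/
theorem loopMeasure_jumpMatrix_eq (c : X × X →₀ ℕ) (hc : c ≠ 0) :
    G.loopMeasure (Loop.jumpMatrix ⁻¹' {⇑c}) = ENNReal.ofReal (G.stepProd c * loopWeight c) := by
  have hdeg : c.degree ≠ 0 := fun h => hc ((Finsupp.degree_eq_zero_iff _).1 h)
  rw [loopMeasure_preimage_jumpMatrix G _ (fun h => hc (DFunLike.coe_injective h.symm))]
  have h1 : ∀ n : ℕ, ∑ x : Fin (n + 2) → X,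
        ENNReal.ofReal ((∏ i, G.transition (x i) (x (i + 1))) / ((n : ℝ) + 2)) *
          ({⇑c} : Set (X × X → ℕ)).indicator 1 ⇑(loopType x) =
      ENNReal.ofReal (G.stepProd c * (loopCount (n + 1) c / ((n : ℝ) + 2))) := by
    intro n
    have h2 : G.stepProd c * (loopCount (n + 1) c / ((n : ℝ) + 2)) =
        ∑ x : Fin (n + 2) → X, if loopType x = c then G.stepProd c / ((n : ℝ) + 2) else 0 := by
      rw [loopCount, ← Finset.sum_filter, Finset.sum_const, nsmul_eq_mul]
      ring
    rw [h2, ENNReal.ofReal_sum_of_nonneg]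
    · refine Finset.sum_congr rfl fun x _ => ?_
      by_cases h : loopType x = c
      · rw [prod_transition_eq_stepProd, h]
        simp
      · have h' : ¬ (⇑(loopType x) ∈ ({⇑c} : Set (X × X → ℕ))) := fun h3 =>
          h (DFunLike.coe_injective h3)
        rw [Set.indicator_of_notMem h', if_neg h, mul_zero, ENNReal.ofReal_zero]
    · intro x _
      split_ifs
      · exact div_nonneg (stepProd_nonneg _) (by positivity)
      · exact le_rfl
  rw [tsum_congr h1, tsum_eq_single (c.degree - 2)]
  · rcases Nat.lt_or_ge c.degree 2 with h2 | h2
    · -- a loop with one step stays put, which has probability zero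
      have h3 : c.degree = 1 := by omega
      rw [loopCount_eq_zero _ _ (by omega)]
      have h4 : G.stepProd c * loopWeight c = 0 := by
        rw [loopWeight, h3]
        rcases Nat.eq_zero_or_pos (loopCount (1 - 1) c) with h5 | h5
        · rw [h5]; simp
        · obtain ⟨x, hx⟩ := Finset.card_pos.1 h5
          rw [← (Finset.mem_filter.1 hx).2, ← prod_transition_eq_stepProd]
          have h6 : ∀ i : Fin (1 - 1 + 1), G.transition (x i) (x (i + 1)) = 0 := by
            intro i
            change Fin 1 at i
            rw [Subsingleton.elim (i + 1) i, transition_self]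
          rw [Finset.prod_eq_zero (Finset.mem_univ 0) (h6 0), zero_mul]
      rw [h4]
      simp
    · have h3 : c.degree - 2 + 1 = c.degree - 1 := by omega
      rw [loopWeight, h3]
      congr 3
      rw [Nat.cast_sub h2]
      push_cast
      ring
  · intro n hn
    rw [loopCount_eq_zero _ _ (by omega)]
    simp

theorem trace_transition_pow_div_nonneg {X : Type*} [Fintype X] [DecidableEq X]
    {G : ConductanceGraph X} (n : ℕ) : 0 ≤ (G.transition ^ (n + 2)).trace / ((n : ℝ) + 2) := by
  rw [trace_pow_succ]
  exact div_nonneg (Finset.sum_nonneg fun x _ => prod_transition_nonneg x) (by positivity)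

theorem neg_log_det_nonneg {X : Type*} [Fintype X] [DecidableEq X] {G : ConductanceGraph X}
    (hG : G.IsTransient) : 0 ≤ -Real.log (1 - G.transition).det :=
  (hasSum_trace_transition_pow hG).nonneg trace_transition_pow_div_nonneg

/-- The loops that jump have total mass `- log det (1 - P)`. -/
theorem loopMeasure_jumpMatrix_ne_zero (hG : G.IsTransient) :
    G.loopMeasure (Loop.jumpMatrix ⁻¹' {0}ᶜ) =
      ENNReal.ofReal (-Real.log (1 - G.transition).det) := by
  have hs := hasSum_trace_transition_pow hG
  rw [loopMeasure_preimage_jumpMatrix G _ (by simp), ← hs.tsum_eq,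
    ENNReal.ofReal_tsum_of_nonneg trace_transition_pow_div_nonneg hs.summable]
  refine tsum_congr fun n => ?_
  rw [trace_pow_succ, Finset.sum_div, ENNReal.ofReal_sum_of_nonneg]
  · refine Finset.sum_congr rfl fun x _ => ?_
    rw [Set.indicator_of_mem, Pi.one_apply, mul_one]
    intro h
    have h1 : loopType x = 0 := DFunLike.coe_injective h
    have h2 := degree_loopType x
    rw [h1, map_zero] at h2
    omega
  · intro x _
    exact div_nonneg (prod_transition_nonneg x) (by positivity)

end ConductanceGraph

end LoopMeasure

/-! ### Poisson point processes -/

section Poisson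

namespace IsPoissonPointProcess

variable {Ω E : Type*} [MeasurableSpace Ω] [MeasurableSpace E] {Pr : Measure Ω} {ν : Measure E}
  {L : Ω → Measure E}

theorem measurable_apply (hL : IsPoissonPointProcess Pr ν L) {A : Set E} (hA : MeasurableSet A) :
    Measurable fun ω => L ω A :=
  (Measure.measurable_coe hA).comp hL.measurable

theorem measure_eq_natCast (hL : IsPoissonPointProcess Pr ν L) {A : Set E} (hA : MeasurableSet A)
    (hν : ν A ≠ ⊤) (n : ℕ) :
    Pr {ω | L ω A = n} =
      ENNReal.ofReal (Real.exp (-(ν A).toReal) * (ν A).toReal ^ n / n.factorial) := by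
  have h1 : Pr {ω | L ω A = n} = Measure.map (fun ω => L ω A) Pr {(n : ENNReal)} := by
    rw [Measure.map_apply (hL.measurable_apply hA) (measurableSet_singleton _)]
    rfl
  have h2 : (fun n : ℕ => (n : ENNReal)) ⁻¹' {(n : ENNReal)} = {n} := by
    ext m
    simp
  rw [h1, hL.poisson A hA hν, Measure.map_apply (measurable_of_countable _)
    (measurableSet_singleton _), h2, poissonMeasure_singleton]
  rfl

theorem measure_iInter_eq_natCast (hL : IsPoissonPointProcess Pr ν L) {ι : Type*} [Fintype ι]
    {A : ι → Set E} (hA : ∀ i, MeasurableSet (A i))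
    (hd : Pairwise fun i j => Disjoint (A i) (A j)) (hν : ∀ i, ν (A i) ≠ ⊤) (n : ι → ℕ) :
    Pr (⋂ i, {ω | L ω (A i) = n i}) = ENNReal.ofReal (∏ i,
      (Real.exp (-(ν (A i)).toReal) * (ν (A i)).toReal ^ n i / (n i).factorial)) := by
  let e := Fintype.equivFin ι
  have h1 : iIndepFun (fun i ω => L ω (A i)) Pr := by
    have h2 := hL.indep _ (fun j => A (e.symm j)) (fun j => hA _)
      (fun i j hij => hd fun h => hij (e.symm.injective h))
    have h3 := h2.precomp e.injective
    simpa only [Equiv.symm_apply_apply] using h3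
  have h2 := h1.measure_inter_preimage_eq_mul (S := Finset.univ)
    (sets := fun i => {((n i : ℕ) : ENNReal)}) fun i _ => measurableSet_singleton _
  have h3 : ⋂ i, {ω | L ω (A i) = n i} =
      ⋂ i ∈ Finset.univ, (fun ω => L ω (A i)) ⁻¹' {((n i : ℕ) : ENNReal)} := by
    ext ω
    simp
  rw [h3, h2, ENNReal.ofReal_prod_of_nonneg fun i _ => by positivity]
  exact Finset.prod_congr rfl fun i _ => hL.measure_eq_natCast (hA i) (hν i) (n i)

end IsPoissonPointProcess

theorem tsum_mul_eq_sum_properParts {s : Type*} [DecidableEq s] [Finite s] (k : s →₀ ℕ)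
    (v : (s → ℕ) → ENNReal) (hv : ∀ c, ¬ c ≤ ⇑k → v c = 0) (e : s) :
    ∑' c : s → ℕ, (c e : ENNReal) * v c = ∑ c : properParts k, (c.1 e : ENNReal) * v c.1 := by
  rw [tsum_eq_sum (s := (properParts k).map ⟨_, DFunLike.coe_injective⟩), Finset.sum_map,
    ← Finset.sum_coe_sort]
  · rfl
  · intro c hc
    by_cases hck : c ≤ ⇑k
    · by_cases hc0 : c = 0
      · simp [hc0]
      · refine absurd ?_ hc
        refine Finset.mem_map.2 ⟨Finsupp.equivFunOnFinite.symm c, ?_, rfl⟩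
        refine Finset.mem_erase.2 ⟨fun h => hc0 ?_, Finset.mem_Iic.2 hck⟩
        exact congrArg (fun f : s →₀ ℕ => (f : s → ℕ)) h
    · rw [hv c hck, mul_zero]

/-- A family of multiplicities `v c` of matrices `c` adds up to `k` if and only if no matrix that
is not below `k` occurs, and those below it occur a finite number of times, with sum `k`. -/
theorem forall_tsum_mul_eq_iff {s : Type*} [DecidableEq s] [Finite s] (k : s →₀ ℕ)
    (v : (s → ℕ) → ENNReal) (hv : ∀ c, ∃ m : ℕ∞, v c = m) :
    (∀ e, ∑' c : s → ℕ, (c e : ENNReal) * v c = k e) ↔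
      (∀ c, ¬ c ≤ ⇑k → v c = 0) ∧ ∃ n ∈ multiplicities (fun c : properParts k => c.1) k.degree k,
        ∀ c : properParts k, v c.1 = n c := by
  have hcast : ∀ (e : s) (n : properParts k → ℕ), (∀ c : properParts k, v c.1 = n c) →
      ∑ c : properParts k, (c.1 e : ENNReal) * v c.1 =
        (((∑ c : properParts k, n c • c.1 : s →₀ ℕ) e : ℕ) : ENNReal) := by
    intro e n hn
    rw [Finsupp.finsetSum_apply, Nat.cast_sum]
    refine Finset.sum_congr rfl fun c _ => ?_
    rw [hn, Finsupp.smul_apply, smul_eq_mul, Nat.cast_mul, mul_comm]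
  constructor
  · intro h
    have hle : ∀ c e, (c e : ENNReal) * v c ≤ k e := fun c e => by
      rw [← h e]
      exact ENNReal.le_tsum c
    have h0 : ∀ c, ¬ c ≤ ⇑k → v c = 0 := by
      intro c hc
      obtain ⟨e, he⟩ := not_forall.1 hc
      obtain ⟨m, hm⟩ := hv c
      by_contra hne
      have hm1 : (1 : ENNReal) ≤ v c := by
        rw [hm] at hne ⊢
        have : m ≠ 0 := fun h0 => hne (by rw [h0, ENat.toENNReal_zero])
        exact_mod_cast Order.one_le_iff_pos.2 (pos_iff_ne_zero.2 this)
      have h1 : (c e : ENNReal) ≤ k e :=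
        (le_mul_of_one_le_right (by positivity) hm1).trans (hle c e)
      exact he (by exact_mod_cast h1)
    refine ⟨h0, ?_⟩
    have hfin : ∀ c : properParts k, ∃ n : ℕ, v c.1 = n := by
      intro c
      obtain ⟨m, hm⟩ := hv c.1
      obtain ⟨e, he⟩ : ∃ e, c.1 e ≠ 0 := by
        by_contra! h1
        exact ne_zero_of_mem_properParts c (Finsupp.ext h1)
      have h1 : v c.1 ≤ k e := by
        refine le_trans (le_mul_of_one_le_left (by positivity) ?_) (hle c.1 e)
        exact_mod_cast Nat.one_le_iff_ne_zero.2 he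
      have hm' : m ≠ ⊤ := by
        rintro rfl
        rw [hm] at h1
        exact absurd h1 (by simp)
      exact ⟨m.toNat, by rw [hm, ← ENat.natCast_toNat hm']; rfl⟩
    choose n hn using hfin
    refine ⟨n, ?_, hn⟩
    rw [mem_multiplicities ne_zero_of_mem_properParts le_rfl]
    ext e
    have h1 := h e
    rw [tsum_mul_eq_sum_properParts k v h0, hcast e n hn] at h1
    exact_mod_cast h1
  · rintro ⟨h0, n, hn, hvn⟩ e
    rw [mem_multiplicities ne_zero_of_mem_properParts le_rfl] at hn
    rw [tsum_mul_eq_sum_properParts k v h0, hcast e n hvn, hn]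

variable {X : Type*} [Fintype X] [DecidableEq X] [MeasurableSpace X] [DiscreteMeasurableSpace X]

theorem jumpingNumber_eq_tsum {Ω : Type*} (L : Ω → Measure (Loop X)) (ω : Ω) (e : X × X) :
    jumpingNumber L ω e.1 e.2 =
      ∑' c : X × X → ℕ, (c e : ENNReal) * L ω (Loop.jumpMatrix ⁻¹' {c}) := by
  have h1 : jumpingNumber L ω e.1 e.2 =
      ∫⁻ c, (c e : ENNReal) ∂((L ω).map (Loop.jumpMatrix : Loop X → X × X → ℕ)) := by
    rw [lintegral_map (measurable_of_countable _) measurable_jumpMatrix]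
    rfl
  rw [h1, lintegral_countable']
  refine tsum_congr fun c => ?_
  rw [Measure.map_apply measurable_jumpMatrix (measurableSet_singleton c)]

/-- The sets of loops, indexed by an optional part of `k`: the loops whose jump numbers are this
part, and for `none` the loops whose jump numbers are not below `k`. -/
def loopClass {X : Type*} [DecidableEq X] (k : X × X →₀ ℕ) (o : Option (properParts k)) :
    Set (Loop X) :=
  Loop.jumpMatrix ⁻¹' o.elim {c | ¬ c ≤ ⇑k} fun c => {⇑c.1}

theorem measurableSet_loopClass (k : X × X →₀ ℕ) (o : Option (properParts k)) :
    MeasurableSet (loopClass k o) :=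
  measurable_jumpMatrix (Set.to_countable _).measurableSet

theorem pairwise_disjoint_loopClass {X : Type*} [DecidableEq X] (k : X × X →₀ ℕ) :
    Pairwise fun o o' => Disjoint (loopClass k o) (loopClass k o') := by
  have hle : ∀ c : properParts k, c.1 ≤ k := fun c =>
    Finset.mem_Iic.1 (Finset.mem_erase.1 c.2).2
  rintro (_ | c) (_ | c') hne
  · exact absurd rfl hne
  · refine Disjoint.preimage _ (Set.disjoint_singleton_right.2 fun h => h (hle c'))
  · refine Disjoint.preimage _ (Set.disjoint_singleton_left.2 fun h => h (hle c))
  · refine Disjoint.preimage _ (Set.disjoint_singleton.2 fun h => hne ?_)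
    rw [Subtype.ext (DFunLike.coe_injective h)]

theorem iUnion_loopClass {X : Type*} [Fintype X] [DecidableEq X] (k : X × X →₀ ℕ) :
    ⋃ o, loopClass k o = Loop.jumpMatrix ⁻¹' {0}ᶜ := by
  ext l
  simp only [Set.mem_iUnion, Set.mem_preimage, Set.mem_compl_iff, Set.mem_singleton_iff]
  constructor
  · rintro ⟨_ | c, h⟩ h0
    · refine h ?_
      rw [h0]
      exact fun e => Nat.zero_le _
    · have h' : Loop.jumpMatrix l = ⇑c.1 := h
      exact ne_zero_of_mem_properParts c (DFunLike.coe_injective (h'.symm.trans h0))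
  · intro h0
    by_cases h : Loop.jumpMatrix l ≤ ⇑k
    · refine ⟨some ⟨Finsupp.equivFunOnFinite.symm (Loop.jumpMatrix l), ?_⟩, rfl⟩
      refine Finset.mem_erase.2 ⟨fun h1 => h0 ?_, Finset.mem_Iic.2 h⟩
      exact congrArg (fun f : X × X →₀ ℕ => (f : X × X → ℕ)) h1
    · exact ⟨none, h⟩

theorem measure_loopClass_none_eq_zero_iff {X : Type*} [Fintype X] [DecidableEq X]
    [MeasurableSpace X] (k : X × X →₀ ℕ) (Λ : Measure (Loop X)) :
    Λ (loopClass k none) = 0 ↔ ∀ c : X × X → ℕ, ¬ c ≤ ⇑k → Λ (Loop.jumpMatrix ⁻¹' {c}) = 0 := by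
  constructor
  · intro h c hc
    refine measure_mono_null (Set.preimage_mono ?_) h
    rintro _ rfl
    exact hc
  · intro h
    have h1 : loopClass k none =
        ⋃ c ∈ {c : X × X → ℕ | ¬ c ≤ ⇑k}, Loop.jumpMatrix ⁻¹' {c} := by
      ext l
      simp [loopClass]
    rw [h1, measure_biUnion_null_iff (Set.to_countable _)]
    exact h

/-- The jump numbers of the loops of a point process are `k` exactly when the loops of each class
below `k` occur with multiplicities that add up to `k`, and no other loop that jumps occurs. -/
theorem setOf_jumpingNumber_eq {Ω : Type*} (L : Ω → Measure (Loop X))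
    (hL : ∀ ω A, MeasurableSet A → ∃ n : ℕ∞, L ω A = (n : ENNReal)) (k : X × X →₀ ℕ) :
    {ω | ∀ x y, jumpingNumber L ω x y = k (x, y)} =
      ⋃ n ∈ multiplicities (fun c : properParts k => c.1) k.degree k,
        ⋂ o, {ω | L ω (loopClass k o) = ((Option.elim o 0 n : ℕ) : ENNReal)} := by
  ext ω
  have h1 : (∀ x y, jumpingNumber L ω x y = k (x, y)) ↔
      ∀ e, ∑' c : X × X → ℕ, (c e : ENNReal) * L ω (Loop.jumpMatrix ⁻¹' {c}) = k e := by
    simp only [← jumpingNumber_eq_tsum, Prod.forall]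
  rw [Set.mem_ofPred_eq, h1, forall_tsum_mul_eq_iff k (fun c => L ω (Loop.jumpMatrix ⁻¹' {c}))
    fun c => hL ω _ (measurable_jumpMatrix (measurableSet_singleton c)),
    ← measure_loopClass_none_eq_zero_iff]
  simp only [Set.mem_iUnion, Set.mem_iInter, Set.mem_ofPred_eq, Option.forall, Option.elim_none,
    Option.elim_some, exists_prop, Nat.cast_zero]
  constructor
  · rintro ⟨h0, n, hn, h⟩
    exact ⟨n, hn, h0, h⟩
  · rintro ⟨n, hn, h0, h⟩
    exact ⟨h0, n, hn, h⟩

theorem ConductanceGraph.stepProd_sum_smul {X ι : Type*} [Fintype X] [Fintype ι]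
    (G : ConductanceGraph X) (c : ι → X × X →₀ ℕ) (n : ι → ℕ) :
    G.stepProd (∑ i, n i • c i) = ∏ i, G.stepProd (c i) ^ n i := by
  simp only [ConductanceGraph.stepProd, Finsupp.finsetSum_apply, Finsupp.smul_apply, smul_eq_mul,
    ← Finset.prod_pow_eq_pow_sum, ← Finset.prod_pow]
  rw [Finset.prod_comm]
  refine Finset.prod_congr rfl fun i _ => Finset.prod_congr rfl fun e _ => ?_
  rw [← pow_mul, mul_comm]

theorem loopWeight_nonneg {X : Type*} [Fintype X] [DecidableEq X] (c : X × X →₀ ℕ) :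
    0 ≤ loopWeight c :=
  div_nonneg (Nat.cast_nonneg _) (Nat.cast_nonneg _)

/-- The law of the jump numbers in terms of the compound Poisson weights. -/
theorem measureReal_jumpingNumber_eq (G : ConductanceGraph X) (hG : G.IsTransient)
    {Ω : Type*} [MeasurableSpace Ω] (Pr : Measure Ω) (k : X × X →₀ ℕ) {α : ℝ} (hα : 0 < α)
    (L : Ω → Measure (Loop X))
    (hL : IsPoissonPointProcess Pr (ENNReal.ofReal α • G.loopMeasure) L) :
    Pr.real {ω | ∀ x y, jumpingNumber L ω x y = k (x, y)} =
      (1 - G.transition).det ^ α * (G.stepProd k *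
        ∑ n ∈ multiplicities (fun c : properParts k => c.1) k.degree k,
          poissonWeight (fun c : properParts k => α * loopWeight c.1) n) := by
  set ν := ENNReal.ofReal α • G.loopMeasure with hνdef
  have hdet := ConductanceGraph.det_one_sub_transition_pos hG
  have hlog := ConductanceGraph.neg_log_det_nonneg hG
  have htot : ν (⋃ o, loopClass k o) = ENNReal.ofReal (α * -Real.log (1 - G.transition).det) := by
    rw [iUnion_loopClass, hνdef, Measure.smul_apply,
      ConductanceGraph.loopMeasure_jumpMatrix_ne_zero hG, smul_eq_mul, ENNReal.ofReal_mul hα.le]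
  have hfin : ∀ o, ν (loopClass k o) ≠ ⊤ := fun o =>
    ne_top_of_le_ne_top (htot ▸ ENNReal.ofReal_ne_top) (measure_mono (Set.subset_iUnion _ o))
  have hsome : ∀ c : properParts k, (ν (loopClass k (some c))).toReal =
      α * (G.stepProd c.1 * loopWeight c.1) := by
    intro c
    have h1 : loopClass k (some c) = Loop.jumpMatrix ⁻¹' {⇑c.1} := rfl
    rw [h1, hνdef, Measure.smul_apply, ConductanceGraph.loopMeasure_jumpMatrix_eq _
      (ne_zero_of_mem_properParts c), smul_eq_mul, ← ENNReal.ofReal_mul hα.le,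
      ENNReal.toReal_ofReal]
    exact mul_nonneg hα.le
      (mul_nonneg (ConductanceGraph.stepProd_nonneg _) (loopWeight_nonneg _))
  have hsum : ∑ o, (ν (loopClass k o)).toReal = α * -Real.log (1 - G.transition).det := by
    rw [← ENNReal.toReal_sum fun o _ => hfin o, ← tsum_fintype (L := .unconditional _),
      ← measure_iUnion (pairwise_disjoint_loopClass k) (measurableSet_loopClass k), htot,
      ENNReal.toReal_ofReal (mul_nonneg hα.le hlog)]
  have hexp : ∏ o, Real.exp (-(ν (loopClass k o)).toReal) = (1 - G.transition).det ^ α := by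
    rw [← Real.exp_sum, Finset.sum_neg_distrib, hsum, Real.rpow_def_of_pos hdet]
    congr 1
    ring
  have hterm : ∀ n ∈ multiplicities (fun c : properParts k => c.1) k.degree k,
      Pr (⋂ o, {ω | L ω (loopClass k o) = ((Option.elim o 0 n : ℕ) : ENNReal)}) =
        ENNReal.ofReal ((1 - G.transition).det ^ α * (G.stepProd k *
          poissonWeight (fun c : properParts k => α * loopWeight c.1) n)) := by
    intro n hn
    rw [mem_multiplicities ne_zero_of_mem_properParts le_rfl] at hn
    rw [hL.measure_iInter_eq_natCast (measurableSet_loopClass k) (pairwise_disjoint_loopClass k)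
      hfin]
    congr 1
    simp only [mul_div_assoc]
    rw [Finset.prod_mul_distrib, hexp, Fintype.prod_option]
    congr 1
    have hprod : G.stepProd k = ∏ c : properParts k, G.stepProd c.1 ^ n c := by
      rw [← ConductanceGraph.stepProd_sum_smul, hn]
    rw [hprod, poissonWeight, ← Finset.prod_mul_distrib]
    simp only [Option.elim_none, Option.elim_some, pow_zero, Nat.factorial_zero, Nat.cast_one,
      div_one, one_mul]
    refine Finset.prod_congr rfl fun c _ => ?_
    rw [hsome]
    ring
  have hnn : ∀ n : properParts k → ℕ, 0 ≤ (1 - G.transition).det ^ α * (G.stepProd k *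
      poissonWeight (fun c : properParts k => α * loopWeight c.1) n) := fun n =>
    mul_nonneg (Real.rpow_nonneg hdet.le _) (mul_nonneg (ConductanceGraph.stepProd_nonneg _)
      (Finset.prod_nonneg fun c _ => div_nonneg
        (pow_nonneg (mul_nonneg hα.le (loopWeight_nonneg _)) _) (Nat.cast_nonneg _)))
  rw [measureReal_def, setOf_jumpingNumber_eq L hL.counting k, measure_biUnion_finset,
    Finset.sum_congr rfl hterm, ← ENNReal.ofReal_sum_of_nonneg fun n _ => hnn n,
    ENNReal.toReal_ofReal (Finset.sum_nonneg fun n _ => hnn n), Finset.mul_sum, Finset.mul_sum]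
  · intro n _ n' _ hne
    refine Set.disjoint_left.2 fun ω h h' => hne (funext fun c => ?_)
    have h1 := Set.mem_iInter.1 h (some c)
    have h2 := Set.mem_iInter.1 h' (some c)
    exact_mod_cast (h1.symm.trans h2 : ((n c : ℕ) : ENNReal) = (n' c : ℕ))
  · intro n _
    exact MeasurableSet.iInter fun o =>
      hL.measurable_apply (measurableSet_loopClass k o) (measurableSet_singleton _)

end Poisson

theorem mainTheorem2 {X : Type*} [Fintype X] [DecidableEq X] [MeasurableSpace X]
    [DiscreteMeasurableSpace X] (G : ConductanceGraph X) (hG : G.IsTransient)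
    {Ω : Type*} [MeasurableSpace Ω] (Pr : Measure Ω) [IsProbabilityMeasure Pr]
    (k : Matrix X X ℕ) (hk : IsEulerianNetwork G.graph k) :
    (∀ (α : ℝ), 0 < α → ∀ L : Ω → Measure (Loop X),
      IsPoissonPointProcess Pr (ENNReal.ofReal α • G.loopMeasure) L →
        Pr.real {ω | ∀ x y, jumpingNumber L ω x y = (k x y : ENNReal)} =
          permanentCoeff α k / (∏ x, ((vertexNumber k x).factorial : ℝ)) *
            (1 - G.transition).det ^ α * ∏ x, ∏ y, G.transition x y ^ k x y) ∧
    (∀ L : Ω → Measure (Loop X), IsPoissonPointProcess Pr G.loopMeasure L →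
        Pr.real {ω | ∀ x y, jumpingNumber L ω x y = (k x y : ENNReal)} =
          (1 - G.transition).det *
            ((∏ x, ((vertexNumber k x).factorial : ℝ)) / ∏ x, ∏ y, ((k x y).factorial : ℝ)) *
              ∏ x, ∏ y, G.transition x y ^ k x y) := by
  let j : X × X →₀ ℕ := Finsupp.equivFunOnFinite.symm fun e : X × X => k e.1 e.2
  have hstep : G.stepProd j = ∏ x, ∏ y, G.transition x y ^ k x y := Fintype.prod_prod_type _
  have part1 : ∀ (α : ℝ), 0 < α → ∀ L : Ω → Measure (Loop X),
      IsPoissonPointProcess Pr (ENNReal.ofReal α • G.loopMeasure) L →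
        Pr.real {ω | ∀ x y, jumpingNumber L ω x y = (k x y : ENNReal)} =
          permanentCoeff α k / (∏ x, ((vertexNumber k x).factorial : ℝ)) *
            (1 - G.transition).det ^ α * ∏ x, ∏ y, G.transition x y ^ k x y := by
    intro α hα L hL
    have hcoeff : MvPowerSeries.coeff j (permanentSeries X α) =
        permanentCoeff α k / ∏ x, ((vertexNumber k x).factorial : ℝ) := rfl
    refine (measureReal_jumpingNumber_eq G hG Pr j hα L hL).trans ?_
    rw [← coeff_permanentSeries_eq_sum, hcoeff, hstep]
    ring
  refine ⟨part1, fun L hL => ?_⟩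
  rw [part1 1 one_pos L (by rwa [ENNReal.ofReal_one, one_smul]), Real.rpow_one]
  have h1 : permanentCoeff 1 k * ∏ x, ∏ y, ((k x y).factorial : ℝ) =
      (∏ x, ((vertexNumber k x).factorial : ℝ)) ^ 2 := by
    have h2 := coeff_closedPermanent_one_mul j hk.eulerian
    rwa [Fintype.prod_prod_type] at h2
  have h3 : ∏ x, ∏ y, ((k x y).factorial : ℝ) ≠ 0 :=
    Finset.prod_ne_zero_iff.2 fun x _ => Finset.prod_ne_zero_iff.2 fun y _ => by positivity
  have h4 : ∏ x, ((vertexNumber k x).factorial : ℝ) ≠ 0 :=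
    Finset.prod_ne_zero_iff.2 fun x _ => by positivity
  have h5 : permanentCoeff 1 k / (∏ x, ((vertexNumber k x).factorial : ℝ)) =
      (∏ x, ((vertexNumber k x).factorial : ℝ)) / ∏ x, ∏ y, ((k x y).factorial : ℝ) := by
    rw [div_eq_div_iff h4 h3, h1, sq]
  rw [h5]
  ring
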